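/- Let $\mathcal P_2$ be the algebra of complex polynomials in two non-commuting indeterminates $X_1,X_2$, with the conjugate-linear involution $\mathcal J$ that reverses words and exchanges $X_1$ and $X_2$. Let $\phi:\mathcal P_2\to\mathbb C$ be a linear functional that is strictly positive, i.e. $\phi(\mathcal J(P)P)>0$ for every nonzero polynomial $P$ in $X_1$ alone, and put $K_\phi(k,j)=s_{k,j}=\phi(\mathcal J(X_1^k)X_1^j)$, $k,j\ge 0$. *Parameters.* There is exactly one family $\{\gamma_{k,j}\}_{0\le k<j}$ of complex numbers with $|\gamma_{k,j}|<1$ such that, with $d_{k,j}=(1-|\gamma_{k,j}|^2)^{1/2}$, $$s_{k,j}=s_{k,k}^{1/2}\,(U_{k,j})_{0,0}\,s_{j,j}^{1/2}\qquad(k<j),$$ where $U_{k,j}$ is the $(j-k+1)\times(j-k+1)$ matrix $$U_{k,j}=\prod_{m=k}^{j-1}\ \prod_{i=m+1}^{j}G_{i-m-1}(\gamma_{m,i})$$ (factors in increasing order of $m$, and of $i$ for each $m$) and $G_p(\gamma)$ is the identity matrix except for the block $\begin{bmatrix}\gamma&d\\ d&-\overline\gamma\end{bmatrix}$, $d=(1-|\gamma|^2)^{1/2}$,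 in rows and columns $p,p+1$ (numbered from $0$). *Polynomials.* Let $\varphi_0(X,l)=\varphi_0^\sharp(X,l)=s_{l,l}^{-1/2}$ and, for $n\ge1$, $l\ge0$, $$\varphi_n(X,l)=\tfrac1{d_{l,n+l}}\bigl(X\varphi_{n-1}(X,l+1)-\gamma_{l,n+l}\varphi^\sharp_{n-1}(X,l)\bigr),\qquad \varphi_n^\sharp(X,l)=\tfrac1{d_{l,n+l}}\bigl(-\overline{\gamma}_{l,n+l}X\varphi_{n-1}(X,l+1)+\varphi^\sharp_{n-1}(X,l)\bigr).$$ For every $l$, $\{\varphi_n(X,l)\}_{n\ge0}$ is the family of orthonormal polynomials ($\deg\varphi_n(X,l)=n$, positive leading coefficient) of the shifted kernel $(\alpha,\beta)\mapsto s_{\alpha+l,\beta+l}$. *Arrays.* Let $\mathcal R_1$ be the algebra of lower triangular arrays $[a_{k,j}]_{k,j\ge0}$ of complex numbers ($a_{k,j}=0$ for $k<j$) with entrywise addition and $(ab)_{k,j}=\sum_l a_{k,l}b_{l,j}$, and let $\to$ denote entrywise convergence in $\mathcal R_1$. For $k\ge j$ let $(\Phi_n)_{k,j}$ and $(\Phi_n^\sharp)_{k,j}$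 be the coefficients of $X^{k-j}$ in $\varphi_n(X,j)$ and $\varphi_n^\sharp(X,j)$, respectively. *Spectral factor.* For Hilbert spaces $F_0,F_1,\dots$, consider lower triangular arrays $\Theta=[\Theta_{k,j}]$, $\Theta_{k,j}\in F_k$, with columns $c_j(\Theta)\in\bigoplus_{k\ge j}F_k$; such $\Theta$ is outer if $\{c_j(\Theta)\}_{j\ge k}$ is total in $\bigoplus_{i\ge k}F_i$ for every $k\ge 0$. Put $K_\Theta(k,j)=c_k(\Theta)^*c_j(\Theta)$, and write $K_1\le K_2$ if $K_2-K_1$ is a positive definite kernel, i.e. $\sum_{k,j}\overline{x}_k(K_2-K_1)(k,j)x_j\ge 0$ for all finitely supported $x$. A spectral factor of $K_\phi$ is an outer $\Theta$ with $K_\Theta\le K_\phi$ such that $K_{\Theta'}\le K_\Theta$ for every outer $\Theta'$ (with any Hilbert spaces $F'_k$) with $K_{\Theta'}\le K_\phi$; here the spaces $F_k$ are taken to be subspaces of $\mathbb C$, so that $\Theta\in\mathcal R_1$, and $\Theta$ is normalized by $\Theta_{n,n}\ge0$. The functional $\phi$ belongs to the Szegő class if $K_\phi$ has such a spectral factor with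 $\Theta_{n,n}>0$ for all $n$. **Theorem.** The functional $\phi$ belongs to the Szegő class if and only if $s_{k,k}\prod_{n>k}d_{k,n}>0$ for every $k\ge0$. In this case the normalized spectral factor $\Theta_\phi$ of $K_\phi$ is unique, every $\Phi_n^\sharp$ is invertible in $\mathcal R_1$, and $$\Phi_n\to0,\qquad(\Phi_n^\sharp)^{-1}\to\Theta_\phi\qquad(n\to\infty).$$ -/

import Mathlib

open Filter Topology Polynomial
open scoped ComplexOrder ComplexConjugate

namespace SzegoArrays

noncomputable section

/-! ### Functionals on noncommutative polynomials in `X₁` and `X₂ = 𝒥(X₁)` -/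

/-- Noncommutative complex polynomials in two indeterminates: finite linear combinations of words
in the letters `0` (for `X₁`) and `1` (for `X₂`). -/
abbrev NCPoly : Type := MonoidAlgebra ℂ (FreeMonoid (Fin 2))

/-- The indeterminate `X₁`. -/
def X₁ : NCPoly := MonoidAlgebra.single (FreeMonoid.of 0) 1

/-- The involution on words: reverse the word and exchange the two letters. -/
def wordInvol (σ : FreeMonoid (Fin 2)) : FreeMonoid (Fin 2) :=
  (FreeMonoid.map Fin.rev σ).reverse

/-- The involution `𝒥 (∑ c_σ X_σ) = ∑ conj c_σ 𝒥(X_σ)`. -/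
def invol (Q : NCPoly) : NCPoly :=
  Q.coeff.sum fun σ c => MonoidAlgebra.single (wordInvol σ) (conj c)

/-- `φ(𝒥(P) P) > 0` for every nonzero polynomial `P` in `X₁` alone. -/
def IsStrictlyPositiveFunctional (φ : NCPoly →ₗ[ℂ] ℂ) : Prop :=
  ∀ P ∈ Algebra.adjoin ℂ {X₁}, P ≠ 0 → 0 < φ (invol P * P)

/-- The kernel `K_φ(k, j) = s_{k,j} = φ(𝒥(X₁^k) X₁^j)`. -/
def momentKernel (φ : NCPoly →ₗ[ℂ] ℂ) : Matrix ℕ ℕ ℂ :=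
  Matrix.of fun k j => φ (invol (X₁ ^ k) * X₁ ^ j)

/-! ### Parameters of a kernel -/

/-- `(1 - |γ|²)^{1/2}`. -/
def defect (g : ℂ) : ℝ := Real.sqrt (1 - ‖g‖ ^ 2)

/-- The `N × N` matrix which is `[[γ, d], [d, -conj γ]]` in the rows and columns `i, i + 1` and the
identity elsewhere. -/
def schurRotation (N i : ℕ) (g : ℂ) : Matrix (Fin N) (Fin N) ℂ :=
  Matrix.of fun r c =>
    if r.val = i ∧ c.val = i then g
    else if r.val = i ∧ c.val = i + 1 then (defect g : ℂ)
    else if r.val = i + 1 ∧ c.val = i then (defect g : ℂ)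
    else if r.val = i + 1 ∧ c.val = i + 1 then -conj g
    else if r = c then 1 else 0

/-- `schurRotation 0 γ_{k,k+1} * schurRotation 1 γ_{k,k+2} * ⋯ * schurRotation (n-1) γ_{k,k+n}`. -/
def schurChain (γ : ℕ → ℕ → ℂ) (N k : ℕ) : ℕ → Matrix (Fin N) (Fin N) ℂ
  | 0 => 1
  | n + 1 => schurChain γ N k n * schurRotation N n (γ k (k + n + 1))

/-- The unitary `U_{k,k+n}`, acting on the first `n + 1` of `N` coordinates: the product of the
chains of `γ_{k,k+1}, …, γ_{k,k+n}`, then of `γ_{k+1,k+2}, …, γ_{k+1,k+n}`, …, and finally of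
`γ_{k+n-1,k+n}`. -/
def latticeU (γ : ℕ → ℕ → ℂ) (N : ℕ) : ℕ → ℕ → Matrix (Fin N) (Fin N) ℂ
  | _, 0 => 1
  | k, n + 1 => schurChain γ N k (n + 1) * latticeU γ N (k + 1) n

/-- `γ = {γ_{k,j}}_{k<j}` is the family of parameters of the kernel `K`:
`s_{k,j} = s_{k,k}^{1/2} (U_{k,j})_{0,0} s_{j,j}^{1/2}`. Entries outside `k < j`, which have no
meaning, are set to `0`. -/
structure IsParameterFamily (K : Matrix ℕ ℕ ℂ) (γ : ℕ → ℕ → ℂ) : Prop where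
  norm_lt_one : ∀ k j, k < j → ‖γ k j‖ < 1
  eq_zero : ∀ k j, j ≤ k → γ k j = 0
  kernel_eq : ∀ k n, K k (k + n) =
    (Real.sqrt (K k k).re : ℂ) * latticeU γ (n + 1) k n 0 0 *
      (Real.sqrt (K (k + n) (k + n)).re : ℂ)

/-! ### Shifted orthogonal polynomials -/

/-- The pair `(φ_n(X,l), φ_n^♯(X,l))`, by recursion on `n`. -/
def polyPair (K : Matrix ℕ ℕ ℂ) (γ : ℕ → ℕ → ℂ) : ℕ → ℕ → ℂ[X] × ℂ[X]
  | 0, l => (C (((Real.sqrt (K l l).re)⁻¹ : ℝ) : ℂ), C (((Real.sqrt (K l l).re)⁻¹ : ℝ) : ℂ))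
  | n + 1, l =>
    (C (((defect (γ l (n + 1 + l)))⁻¹ : ℝ) : ℂ) *
        (X * (polyPair K γ n (l + 1)).1 - C (γ l (n + 1 + l)) * (polyPair K γ n l).2),
      C (((defect (γ l (n + 1 + l)))⁻¹ : ℝ) : ℂ) *
        (-C (conj (γ l (n + 1 + l))) * X * (polyPair K γ n (l + 1)).1 + (polyPair K γ n l).2))

/-- `φ_n(X,l)`. -/
def orthPoly (K : Matrix ℕ ℕ ℂ) (γ : ℕ → ℕ → ℂ) (n l : ℕ) : ℂ[X] := (polyPair K γ n l).1

/-- `φ_n^♯(X,l)`. -/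
def orthPolySharp (K : Matrix ℕ ℕ ℂ) (γ : ℕ → ℕ → ℂ) (n l : ℕ) : ℂ[X] := (polyPair K γ n l).2

/-- The shifted kernel `K^l(α, β) = K(α + l, β + l)`. -/
def shiftKernel (K : Matrix ℕ ℕ ℂ) (l : ℕ) : Matrix ℕ ℕ ℂ :=
  Matrix.of fun α β => K (α + l) (β + l)

/-- The form `⟨P, Q⟩ = ∑ conj (q_α) K(α, β) p_β` on polynomials. -/
def polyInner (K : Matrix ℕ ℕ ℂ) (P Q : ℂ[X]) : ℂ :=
  P.sum fun β p => Q.sum fun α q => conj q * K α β * p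

/-- `p` is the family of orthogonal polynomials of the kernel `K`, i.e. the result of the
Gram-Schmidt procedure applied to `1, X, X², …`. -/
structure IsOrthogonalFamily (K : Matrix ℕ ℕ ℂ) (p : ℕ → ℂ[X]) : Prop where
  natDegree_eq : ∀ n, (p n).natDegree = n
  leadingCoeff_pos : ∀ n, 0 < (p n).leadingCoeff
  orthonormal : ∀ n m, polyInner K (p n) (p m) = if n = m then 1 else 0

/-! ### The algebra of lower triangular arrays -/

/-- Lower triangular arrays `[a_{k,j}]` with complex entries (`a_{k,j} = 0` for `k < j`), with
entrywise addition and `(ab)_{k,j} = ∑_l a_{k,l} b_{l,j}`: the incidence algebra of `ℕ` with the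
reversed order. -/
abbrev LowerArray : Type := IncidenceAlgebra ℂ ℕᵒᵈ

/-- The entry `a_{k,j}`. -/
def entry (a : LowerArray) (k j : ℕ) : ℂ := a (OrderDual.toDual k) (OrderDual.toDual j)

/-- The array whose `(k, j)` entry, for `j ≤ k`, is `f k j`. -/
def mkArray (f : ℕ → ℕ → ℂ) : LowerArray where
  toFun k j := if OrderDual.ofDual j ≤ OrderDual.ofDual k
    then f (OrderDual.ofDual k) (OrderDual.ofDual j) else 0
  eq_zero_of_not_le' := fun _ _ h => if_neg h

/-- The array `Φ_n`: its column `j` holds the coefficients of `φ_n(X,j)`, from the diagonal down. -/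
def arrayPhi (K : Matrix ℕ ℕ ℂ) (γ : ℕ → ℕ → ℂ) (n : ℕ) : LowerArray :=
  mkArray fun k j => (orthPoly K γ n j).coeff (k - j)

/-- The array `Φ_n^♯`: its column `j` holds the coefficients of `φ_n^♯(X,j)`, from the diagonal
down. -/
def arrayPhiSharp (K : Matrix ℕ ℕ ℂ) (γ : ℕ → ℕ → ℂ) (n : ℕ) : LowerArray :=
  mkArray fun k j => (orthPolySharp K γ n j).coeff (k - j)

/-- Entrywise convergence of a sequence of arrays. -/
def ConvergesTo (a : ℕ → LowerArray) (b : LowerArray) : Prop :=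
  ∀ k j, Tendsto (fun n => entry (a n) k j) atTop (𝓝 (entry b k j))

/-! ### Spectral factorization -/

/-- The order on kernels: `K₂ - K₁` is positive (semi)definite. -/
def KernelLE (K₁ K₂ : Matrix ℕ ℕ ℂ) : Prop := (K₂ - K₁).PosSemidef

section Family

variable {F : ℕ → Type*} [∀ n, NormedAddCommGroup (F n)] [∀ n, InnerProductSpace ℂ (F n)]

/-- An array `Θ_{k,j} ∈ ℒ(ℂ, F_k) = F_k`, given by its square summable columns
`c_j ∈ ⨁ F_k`, is lower triangular. -/
def IsLowerTriangular (c : ℕ → lp F 2) : Prop := ∀ j k, k < j → c j k = 0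

/-- For each `k`, the columns `c_j`, `j ≥ k`, are total in `⨁_{i ≥ k} F_i`. -/
def IsOuter (c : ℕ → lp F 2) : Prop :=
  ∀ k, closure (Submodule.span ℂ {x | ∃ j, k ≤ j ∧ x = c j} : Set (lp F 2)) =
    {x | ∀ i, i < k → x i = 0}

/-- `K_Θ(k, j) = c_k(Θ)^* c_j(Θ)`. -/
def columnKernel (c : ℕ → lp F 2) : Matrix ℕ ℕ ℂ := Matrix.of fun k j => inner ℂ (c k) (c j)

/-- The outer lower triangular array with columns `c` satisfies `K_Θ ≤ K` and is maximal among all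
outer lower triangular arrays with this property, for all families of Hilbert spaces. -/
structure IsMaximalOuter (K : Matrix ℕ ℕ ℂ) (c : ℕ → lp F 2) : Prop where
  lower : IsLowerTriangular c
  outer : IsOuter c
  le : KernelLE (columnKernel c) K
  maximal : ∀ (F' : ℕ → Type) [∀ n, NormedAddCommGroup (F' n)]
    [∀ n, InnerProductSpace ℂ (F' n)] [∀ n, CompleteSpace (F' n)] (c' : ℕ → lp F' 2),
    IsLowerTriangular c' → IsOuter c' → KernelLE (columnKernel c') K →
      KernelLE (columnKernel c') (columnKernel c)

end Family

/-- `Θ` is the spectral factor of the scalar kernel `K`, normalized by `Θ_{n,n} ≥ 0`. As the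
spaces `F_n` are at most one-dimensional, they are taken to be subspaces of `ℂ`. -/
def IsSpectralFactor (K : Matrix ℕ ℕ ℂ) (Θ : LowerArray) : Prop :=
  ∃ (F : ℕ → Submodule ℂ ℂ) (c : ℕ → lp (fun n => F n) 2),
    IsMaximalOuter K c ∧ (∀ k j, entry Θ k j = (c j k : ℂ)) ∧ ∀ n, 0 ≤ entry Θ n n

/-- `K` belongs to the Szegő class: its spectral factor has a positive diagonal. -/
def IsSzegoClass (K : Matrix ℕ ℕ ℂ) : Prop :=
  ∃ Θ, IsSpectralFactor K Θ ∧ ∀ n, 0 < entry Θ n n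

/-- `s_{k,k} ∏_{n>k} d_{k,n} > 0` for all `k`. -/
def HasPositiveProducts (K : Matrix ℕ ℕ ℂ) (γ : ℕ → ℕ → ℂ) : Prop :=
  ∀ k, ∃ g : ℝ, 0 < g ∧
    Tendsto (fun m => (K k k).re * ∏ n ∈ Finset.Ioc k m, defect (γ k n)) atTop (𝓝 g)

end

end SzegoArrays

open SzegoArrays

/-! Strict positivity makes the kernel positive definite, hence the Gram matrix of linearly
independent vectors v_0, v_1, … of a Hilbert space. Sending P to ∑ p_i v_{i+l} turns every assertion
into geometry of this sequence.

Let f_{n,l} (`forward v n l`) be the normalized residual of v_{l+n} modulo v_l, …, v_{l+n-1}, and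
g_{n,l} (`backward v n l`) that of v_l modulo v_{l+1}, …, v_{l+n}. The unit vectors g_{n,l} and
f_{n,l+1} are both orthogonal to v_{l+1}, …, v_{l+n}. Gram-Schmidt on this pair, in either order,
produces f_{n+1,l} and g_{n+1,l}; with γ_{l,l+n+1} = ⟨g_{n,l}, f_{n,l+1}⟩ this is the recursion of
the polynomials (`polyVec_polyPair`) and, solved for the other two vectors, the rotation G(γ)
(`rowAct_schurChain`). So these numbers are parameters of the kernel
(`isParameterFamily_reflectionFamily`), and they are the only ones (`IsParameterFamily.unique`).

The residual of v_k modulo v_{k+1}, …, v_{k+n} has norm ‖v_k‖ ∏ d and converges to the innovation of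
v_k, its component orthogonal to all later vectors. As s_{k,k} = ‖v_k‖², the product condition says
that no innovation vanishes (`hasPositiveProducts_iff_innovation_ne_zero`). With e_k the normalized
innovation, Θ_{k,j} = ⟨e_k, v_j⟩ is the spectral factor, and Θ_{k,k} is the norm of the innovation.
It is maximal (`isMaximalOuter_factorColumn`) because what remains of a vector after removing its
components along the e_k lies in every tail span, and a triangular contractive image of such a
remainder has all coordinates zero. It is unique because the kernel determines the inner products of
innovations with the sequence (`IsSpectralFactor.unique`).

Finally Θ Φ_n and Θ Φ_n^♯ have the entries ⟨e_i, f_{n,j}⟩ → 0 and ⟨e_i, g_{n,j}⟩ → ⟨e_i, e_j⟩.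
Cancelling arrays with nonzero diagonal on the left (`ConvergesTo.of_mul_left`) gives both limits.
-/

namespace SzegoArrays

noncomputable section

/-! ### Kernels as Gram matrices -/

section Gram

variable {H : Type*} [SeminormedAddCommGroup H] [InnerProductSpace ℂ H]

lemma inner_linearCombination (v : ℕ → H) (x y : ℕ →₀ ℂ) :
    inner ℂ (Finsupp.linearCombination ℂ v x) (Finsupp.linearCombination ℂ v y) =
      x.sum fun i xi => y.sum fun j yj => star xi * inner ℂ (v i) (v j) * yj := by
  rw [Finsupp.linearCombination_apply, Finsupp.linearCombination_apply, Finsupp.sum_inner]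
  refine Finsupp.sum_congr fun i _ => ?_
  rw [Finsupp.inner_sum]
  refine Finsupp.sum_congr fun j _ => ?_
  simp only [inner_smul_right, inner_smul_left, starRingEnd_apply]
  ring

lemma quadraticForm_gram (v : ℕ → H) (x : ℕ →₀ ℂ) :
    (x.sum fun i xi => x.sum fun j xj => star xi * inner ℂ (v i) (v j) * xj) =
      ((‖Finsupp.linearCombination ℂ v x‖ ^ 2 : ℝ) : ℂ) := by
  rw [← inner_linearCombination, inner_self_eq_norm_sq_to_K]
  norm_cast

lemma linearIndependent_of_posDef {K : Matrix ℕ ℕ ℂ} (hK : K.PosDef) {v : ℕ → H}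
    (hv : ∀ k j, inner ℂ (v k) (v j) = K k j) : LinearIndependent ℂ v := by
  rw [linearIndependent_iff]
  intro x hx
  by_contra h
  have := hK.2 h
  simp only [← hv] at this
  rw [quadraticForm_gram, hx] at this
  simp at this

end Gram

/-- The inner product on finitely supported sequences defined by a positive definite kernel. -/
@[reducible]
def kernelCore {K : Matrix ℕ ℕ ℂ} (hK : K.PosSemidef) :
    PreInnerProductSpace.Core ℂ (ℕ →₀ ℂ) where
  inner x y := x.sum fun i xi => y.sum fun j yj => star xi * K i j * yj
  conj_inner_symm x y := by
    rw [Finsupp.sum_comm]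
    simp only [map_finsuppSum]
    refine Finsupp.sum_congr fun i _ => Finsupp.sum_congr fun j _ => ?_
    rw [← hK.isHermitian.apply i j]
    simp
    ring
  re_inner_nonneg x := by
    have := hK.2 x
    rw [Complex.nonneg_iff] at this
    exact this.1
  add_left x y z := by
    rw [Finsupp.sum_add_index'] <;> simp [← Finsupp.sum_add, add_mul]
  smul_left x y c := by
    rw [Finsupp.sum_smul_index] <;> simp [Finsupp.mul_sum, ← mul_assoc]

/-- Every positive definite kernel is the Gram matrix of a sequence in a Hilbert space. -/
theorem exists_gram_eq {K : Matrix ℕ ℕ ℂ} (hK : K.PosSemidef) :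
    ∃ (H : Type) (_ : NormedAddCommGroup H) (_ : InnerProductSpace ℂ H) (_ : CompleteSpace H)
      (v : ℕ → H), ∀ k j, inner ℂ (v k) (v j) = K k j := by
  let core := kernelCore hK
  let : SeminormedAddCommGroup (ℕ →₀ ℂ) :=
    InnerProductSpace.Core.toSeminormedAddCommGroup (𝕜 := ℂ)
  let : InnerProductSpace ℂ (ℕ →₀ ℂ) := .ofCore _
  -- The completion is Hausdorff, so it also divides out null vectors; semidefiniteness is enough.
  refine ⟨UniformSpace.Completion (ℕ →₀ ℂ), inferInstance, inferInstance, inferInstance,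
    fun k => UniformSpace.Completion.coe' (Finsupp.single k 1), fun k j => ?_⟩
  rw [UniformSpace.Completion.inner_coe]
  change (Finsupp.single k (1 : ℂ)).sum (fun i xi =>
    (Finsupp.single j (1 : ℂ)).sum fun j yj => star xi * K i j * yj) = _
  simp

/-! ### The kernel of a strictly positive functional -/

lemma X₁_pow (k : ℕ) : X₁ ^ k = MonoidAlgebra.single (FreeMonoid.of 0 ^ k) 1 := by
  simp [X₁, MonoidAlgebra.single_pow]

lemma invol_add (P Q : NCPoly) : invol (P + Q) = invol P + invol Q := by
  simp only [invol, MonoidAlgebra.coeff_add]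
  exact Finsupp.sum_add_index' (by simp) (by simp)

lemma invol_smul (c : ℂ) (P : NCPoly) : invol (c • P) = conj c • invol P := by
  simp only [invol, MonoidAlgebra.coeff_smul]
  rw [Finsupp.sum_smul_index (by simp), Finsupp.smul_sum]
  simp

lemma invol_finsuppSum (x : ℕ →₀ ℂ) (f : ℕ → NCPoly) :
    invol (x.sum fun i xi => xi • f i) = x.sum fun i xi => conj xi • invol (f i) := by
  simp only [Finsupp.sum, ← invol_smul]
  exact map_sum (AddMonoidHom.mk' invol invol_add) _ _

lemma freeMonoid_of_pow_injective :
    Function.Injective fun k => (FreeMonoid.of (0 : Fin 2)) ^ k := by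
  intro a b h
  have := congrArg (FreeMonoid.lift fun _ : Fin 2 => Multiplicative.ofAdd 1) h
  simpa [← ofAdd_nsmul] using this

theorem momentKernel_quadraticForm (φ : NCPoly →ₗ[ℂ] ℂ) (x : ℕ →₀ ℂ) :
    (x.sum fun i xi => x.sum fun j xj => star xi * momentKernel φ i j * xj) =
      φ (invol (x.sum fun i xi => xi • X₁ ^ i) * x.sum fun i xi => xi • X₁ ^ i) := by
  rw [invol_finsuppSum]
  simp only [Finsupp.sum, Finset.sum_mul, Finset.mul_sum, map_sum]
  rw [Finset.sum_comm]
  refine Finset.sum_congr rfl fun i _ => Finset.sum_congr rfl fun j _ => ?_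
  simp only [momentKernel, Matrix.of_apply, smul_mul_assoc, mul_smul_comm, map_smul, smul_eq_mul,
    starRingEnd_apply]
  ring

lemma sum_smul_X₁_pow_ne_zero {x : ℕ →₀ ℂ} (hx : x ≠ 0) :
    (x.sum fun i xi => xi • X₁ ^ i) ≠ 0 := by
  obtain ⟨k, hk⟩ := Finsupp.ne_iff.1 hx
  intro h
  apply hk
  have := congrArg (fun P : NCPoly => P.coeff (FreeMonoid.of 0 ^ k)) h
  simp only [MonoidAlgebra.coeff_finsuppSum, X₁_pow, MonoidAlgebra.coeff_smul,
    MonoidAlgebra.coeff_single, MonoidAlgebra.coeff_zero] at this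
  rw [Finsupp.sum_apply, Finsupp.sum, Finset.sum_eq_single k] at this
  · simpa using this
  · intro b _ hb
    have : (FreeMonoid.of (0 : Fin 2)) ^ b ≠ FreeMonoid.of 0 ^ k :=
      fun h => hb (freeMonoid_of_pow_injective h)
    simp [Finsupp.single_eq_of_ne' this]
  · simp +contextual

/-- Polarization: the vectors e_i + e_j and e_i + i e_j give the imaginary and real parts of the
symmetry relation. Positivity of the functional controls only the quadratic form, whereas
`Matrix.PosDef` also asks for symmetry. -/
lemma isHermitian_of_quadraticForm_real {K : Matrix ℕ ℕ ℂ}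
    (h : ∀ x : ℕ →₀ ℂ, (x.sum fun i xi => x.sum fun j xj => star xi * K i j * xj).im = 0) :
    K.IsHermitian := by
  have diag : ∀ k, (K k k).im = 0 := fun k => by simpa using h (Finsupp.single k 1)
  ext i j
  rw [Matrix.conjTranspose_apply]
  by_cases hij : i = j
  · subst hij
    exact Complex.conj_eq_iff_im.2 (diag i)
  have key : ∀ a b : ℂ, (star a * K i i * a + star a * K i j * b +
      (star b * K j i * a + star b * K j j * b)).im = 0 := fun a b => by
    have := h (Finsupp.single i a + Finsupp.single j b)
    rw [Finsupp.sum_add_index' (by simp)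
      (by intros; simp [add_mul, Finsupp.sum_add])] at this
    simpa [Finsupp.sum_add_index', mul_add] using this
  have h1 := key 1 1
  have h2 := key 1 Complex.I
  have := diag i
  have := diag j
  simp at h1 h2
  apply Complex.ext <;> simp <;> linarith

theorem momentKernel_posDef {φ : NCPoly →ₗ[ℂ] ℂ} (hφ : IsStrictlyPositiveFunctional φ) :
    (momentKernel φ).PosDef := by
  have pos : ∀ x : ℕ →₀ ℂ, x ≠ 0 →
      0 < x.sum fun i xi => x.sum fun j xj => star xi * momentKernel φ i j * xj := by
    intro x hx
    rw [momentKernel_quadraticForm]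
    refine hφ _ ?_ (sum_smul_X₁_pow_ne_zero hx)
    unfold Finsupp.sum
    exact Subalgebra.sum_mem _ fun i _ => Subalgebra.smul_mem _
      (Subalgebra.pow_mem _ (Algebra.subset_adjoin (Set.mem_singleton _)) _) _
  refine ⟨isHermitian_of_quadraticForm_real fun x => ?_, pos⟩
  by_cases hx : x = 0
  · simp [hx]
  · exact (Complex.pos_iff.1 (pos x hx)).2.symm

lemma KernelLE.antisymm {K₁ K₂ : Matrix ℕ ℕ ℂ} (h : KernelLE K₁ K₂) (h' : KernelLE K₂ K₁) :
    K₁ = K₂ := by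
  have form : ∀ x : ℕ →₀ ℂ,
      (x.sum fun i xi => x.sum fun j xj => star xi * (K₂ - K₁) i j * xj) = 0 := fun x => by
    refine le_antisymm ?_ (h.2 x)
    have := h'.2 x
    rw [← neg_sub K₂ K₁] at this
    simpa only [Finsupp.sum, Matrix.neg_apply, mul_neg, neg_mul, Finset.sum_neg_distrib,
      Left.nonneg_neg_iff] using this
  -- The difference D has zero quadratic form, so iD is Hermitian as well as D; together these force
  -- D = 0.
  have hI : (Complex.I • (K₂ - K₁)).IsHermitian :=
    isHermitian_of_quadraticForm_real fun x => by
      have : (x.sum fun i xi => x.sum fun j xj => star xi * (Complex.I • (K₂ - K₁)) i j * xj) =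
          Complex.I * (x.sum fun i xi => x.sum fun j xj => star xi * (K₂ - K₁) i j * xj) := by
        simp only [Finsupp.mul_sum, Matrix.smul_apply, smul_eq_mul]
        refine Finsupp.sum_congr fun i _ => Finsupp.sum_congr fun j _ => ?_
        ring
      rw [this, form, mul_zero, Complex.zero_im]
  have h0 : K₂ - K₁ = 0 := by
    have h1 := hI.eq
    rw [Matrix.conjTranspose_smul, h.1.eq, Complex.star_def, Complex.conj_I] at h1
    ext i j
    have := congrFun (congrFun h1 i) j
    simp only [Matrix.smul_apply, smul_eq_mul] at this
    have h2 : 2 * Complex.I * (K₂ - K₁) i j = 0 := by linear_combination -this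
    simpa using h2
  exact (sub_eq_zero.1 h0).symm

/-! ### Lower triangular arrays -/

lemma entry_of_lt (a : LowerArray) {k j : ℕ} (h : k < j) : entry a k j = 0 :=
  IncidenceAlgebra.apply_eq_zero_of_not_le (fun h' => h.not_ge (OrderDual.toDual_le_toDual.1 h')) a

lemma LowerArray.ext_entry {a b : LowerArray} (h : ∀ k j, entry a k j = entry b k j) : a = b :=
  IncidenceAlgebra.ext fun k j _ => h (OrderDual.ofDual k) (OrderDual.ofDual j)

lemma entry_mkArray (f : ℕ → ℕ → ℂ) (k j : ℕ) :
    entry (mkArray f) k j = if j ≤ k then f k j else 0 := rfl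

lemma entry_zero (k j : ℕ) : entry 0 k j = 0 := rfl

lemma entry_one (k j : ℕ) : entry 1 k j = if k = j then 1 else 0 := by
  simp [entry]

lemma entry_mul (a b : LowerArray) (k j : ℕ) :
    entry (a * b) k j = ∑ l ∈ Finset.Icc j k, entry a k l * entry b l j := by
  simp only [entry, IncidenceAlgebra.mul_apply, Finset.Icc_orderDual_def, Finset.sum_map]
  rfl

lemma entry_mul_eq_add {a b : LowerArray} {k j : ℕ} (h : j ≤ k) :
    entry (a * b) k j =
      ∑ l ∈ Finset.Ico j k, entry a k l * entry b l j + entry a k k * entry b k j := by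
  rw [entry_mul, ← Finset.Ico_insert_right h, Finset.sum_insert (by simp), add_comm]

/-- The entries of the right inverse of a lower triangular array, by forward substitution. -/
def rightInvEntry (a : LowerArray) (j : ℕ) (k : ℕ) : ℂ :=
  (entry a k k)⁻¹ * ((if k = j then 1 else 0) -
    ∑ l : Finset.Ico j k, entry a k l * rightInvEntry a j l)
termination_by k
decreasing_by exact (Finset.mem_Ico.1 l.2).2

lemma mul_mkArray_rightInvEntry {a : LowerArray} (ha : ∀ k, entry a k k ≠ 0) :
    a * mkArray (fun k j => rightInvEntry a j k) = 1 := by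
  refine LowerArray.ext_entry fun k j => ?_
  rcases lt_or_ge k j with h | h
  · rw [entry_of_lt _ h, entry_of_lt _ h]
  rw [entry_mul_eq_add h, entry_one]
  have : ∀ l ∈ Finset.Ico j k, entry a k l * entry (mkArray fun k j => rightInvEntry a j k) l j =
      entry a k l * rightInvEntry a j l := fun l hl => by
    rw [entry_mkArray, if_pos (Finset.mem_Ico.1 hl).1]
  rw [Finset.sum_congr rfl this, entry_mkArray, if_pos h, rightInvEntry,
    mul_inv_cancel_left₀ (ha k),
    Finset.sum_coe_sort _ fun l => entry a k l * rightInvEntry a j l]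
  ring

/-- The right inverse again has nonzero diagonal, hence a right inverse of its own, which must be
the original array. -/
lemma isUnit_of_entry_diag_ne_zero {a : LowerArray} (ha : ∀ k, entry a k k ≠ 0) : IsUnit a := by
  set b := mkArray fun k j => rightInvEntry a j k
  have hab : a * b = 1 := mul_mkArray_rightInvEntry ha
  have hb : ∀ k, entry b k k ≠ 0 := fun k h => by
    have := congrArg (fun a => entry a k k) hab
    simp [entry_mul_eq_add le_rfl, h, entry_one] at this
  have hbc := mul_mkArray_rightInvEntry hb
  have hca : mkArray (fun k j => rightInvEntry b j k) = a := by
    rw [← one_mul (mkArray _), ← hab, mul_assoc, hbc, mul_one]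
  rw [hca] at hbc
  exact ⟨⟨a, b, hab, hbc⟩, rfl⟩

/-- Entrywise limits can be cancelled on the left by arrays with nonzero diagonal. -/
lemma ConvergesTo.of_mul_left {b x : ℕ → LowerArray} {B Y : LowerArray} (hb : ConvergesTo b B)
    (hB : ∀ k, entry B k k ≠ 0) (h : ConvergesTo (fun n => b n * x n) (B * Y)) :
    ConvergesTo x Y := by
  intro k j
  induction k using Nat.strong_induction_on with
  | _ k ih =>
    rcases lt_or_ge k j with hkj | hkj
    · simp only [entry_of_lt _ hkj]
      exact tendsto_const_nhds
    -- Forward substitution: the other terms of the (k, j) entry of the product involve only rows of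
    -- x above k, where convergence is known by induction.
    have hprod : Tendsto (fun n => entry (b n) k k * entry (x n) k j) atTop
        (𝓝 (entry B k k * entry Y k j)) := by
      have hsum : Tendsto (fun n => ∑ l ∈ Finset.Ico j k, entry (b n) k l * entry (x n) l j) atTop
          (𝓝 (∑ l ∈ Finset.Ico j k, entry B k l * entry Y l j)) :=
        tendsto_finsetSum _ fun l hl => (hb k l).mul (ih l (Finset.mem_Ico.1 hl).2)
      have := (h k j).sub hsum
      simpa only [entry_mul_eq_add hkj, add_sub_cancel_left] using this
    have hdiv := hprod.div (hb k k) (hB k)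
    rw [mul_div_cancel_left₀ _ (hB k)] at hdiv
    refine hdiv.congr' ?_
    filter_upwards [(hb k k).eventually_ne (hB k)] with n hn
    exact mul_div_cancel_left₀ _ hn

/-! ### Products of elementary rotations -/

lemma defect_pos {g : ℂ} (h : ‖g‖ < 1) : 0 < defect g :=
  Real.sqrt_pos.2 (by nlinarith [norm_nonneg g])

lemma defect_sq {g : ℂ} (h : ‖g‖ < 1) : defect g ^ 2 = 1 - ‖g‖ ^ 2 :=
  Real.sq_sqrt (by nlinarith [norm_nonneg g])

section RowAction

variable {E : Type*} [AddCommGroup E] [Module ℂ E] {N : ℕ}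

/-- The product of a row of vectors with a matrix. -/
def rowAct (W : Fin N → E) (A : Matrix (Fin N) (Fin N) ℂ) : Fin N → E :=
  fun c => ∑ r, A r c • W r

lemma rowAct_one (W : Fin N → E) : rowAct W 1 = W := by
  funext c
  simp [rowAct, Matrix.one_apply]

lemma rowAct_mul (W : Fin N → E) (A B : Matrix (Fin N) (Fin N) ℂ) :
    rowAct W (A * B) = rowAct (rowAct W A) B := by
  funext c
  simp only [rowAct, Matrix.mul_apply, Finset.sum_smul, Finset.smul_sum]
  rw [Finset.sum_comm]
  refine Finset.sum_congr rfl fun s _ => Finset.sum_congr rfl fun r _ => ?_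
  rw [smul_smul, mul_comm]

/-- With scalars as vectors, the formulas for the action of a rotation on a row also compute matrix
entries. -/
lemma mul_apply_eq_rowAct (A B : Matrix (Fin N) (Fin N) ℂ) (r c : Fin N) :
    (A * B) r c = rowAct (A r) B c := by
  simp [rowAct, Matrix.mul_apply, mul_comm]

lemma rowAct_schurRotation_of_ne (W : Fin N → E) (i : ℕ) (g : ℂ) (c : Fin N) (h : c.val ≠ i)
    (h' : c.val ≠ i + 1) : rowAct W (schurRotation N i g) c = W c := by
  simp [rowAct, schurRotation, h, h']

lemma rowAct_schurRotation_fst (W : Fin N → E) {i : ℕ} (hi : i + 1 < N) (g : ℂ) :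
    rowAct W (schurRotation N i g) ⟨i, by omega⟩ =
      g • W ⟨i, by omega⟩ + (defect g : ℂ) • W ⟨i + 1, hi⟩ := by
  have : ∀ r : Fin N, schurRotation N i g r ⟨i, by omega⟩ =
      (if r = ⟨i, by omega⟩ then g else 0) + if r = ⟨i + 1, hi⟩ then (defect g : ℂ) else 0 := by
    intro r
    simp only [schurRotation, Matrix.of_apply, Fin.ext_iff]
    split_ifs <;> first | omega | (simp; done) | (exfalso; simp_all)
  simp [rowAct, this, add_smul, Finset.sum_add_distrib]

lemma rowAct_schurRotation_snd (W : Fin N → E) {i : ℕ} (hi : i + 1 < N) (g : ℂ) :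
    rowAct W (schurRotation N i g) ⟨i + 1, hi⟩ =
      (defect g : ℂ) • W ⟨i, by omega⟩ - conj g • W ⟨i + 1, hi⟩ := by
  have : ∀ r : Fin N, schurRotation N i g r ⟨i + 1, hi⟩ =
      (if r = ⟨i, by omega⟩ then (defect g : ℂ) else 0) -
        if r = ⟨i + 1, hi⟩ then conj g else 0 := by
    intro r
    simp only [schurRotation, Matrix.of_apply, Fin.ext_iff]
    split_ifs <;> first | omega | (simp; done) | (exfalso; simp_all)
  simp [rowAct, this, sub_smul, Finset.sum_sub_distrib]

end RowAction

section Rotations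

variable {γ γ' : ℕ → ℕ → ℂ} {N : ℕ}

lemma schurChain_apply_of_lt_col (k : ℕ) {n : ℕ} (r c : Fin N) (hc : n < c.val) :
    schurChain γ N k n r c = (1 : Matrix (Fin N) (Fin N) ℂ) r c := by
  induction n with
  | zero => rfl
  | succ n ih =>
    rw [schurChain, mul_apply_eq_rowAct, rowAct_schurRotation_of_ne _ _ _ _ (by omega) (by omega),
      ih (by omega)]

lemma schurChain_apply_of_lt_row (k : ℕ) {n : ℕ} (r c : Fin N) (hr : n < r.val) :
    schurChain γ N k n r c = (1 : Matrix (Fin N) (Fin N) ℂ) r c := by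
  induction n generalizing c with
  | zero => rfl
  | succ n ih =>
    have hN : n + 1 < N := hr.trans r.isLt
    rw [schurChain, mul_apply_eq_rowAct]
    by_cases h : c.val = n
    · obtain rfl : c = ⟨n, Nat.lt_of_succ_lt hN⟩ := Fin.ext h
      rw [rowAct_schurRotation_fst _ (by omega), ih _ (by omega), ih _ (by omega),
        Matrix.one_apply_ne (Fin.ne_of_val_ne (by simp; omega)),
        Matrix.one_apply_ne (Fin.ne_of_val_ne (by simp; omega))]
      simp
    by_cases h' : c.val = n + 1
    · obtain rfl : c = ⟨n + 1, hN⟩ := Fin.ext h'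
      rw [rowAct_schurRotation_snd _ (by omega), ih _ (by omega), ih _ (by omega),
        Matrix.one_apply_ne (Fin.ne_of_val_ne (by simp; omega)),
        Matrix.one_apply_ne (Fin.ne_of_val_ne (by simp; omega))]
      simp
    rw [rowAct_schurRotation_of_ne _ _ _ _ h h', ih _ (by omega)]

lemma latticeU_apply_of_lt_row (k : ℕ) {n : ℕ} (r c : Fin N) (hr : n < r.val) :
    latticeU γ N k n r c = (1 : Matrix (Fin N) (Fin N) ℂ) r c := by
  induction n generalizing k with
  | zero => rw [latticeU]
  | succ n ih =>
    rw [latticeU, Matrix.mul_apply]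
    simp only [schurChain_apply_of_lt_row (n := n + 1) _ r _ hr]
    rw [← Matrix.mul_apply, Matrix.one_mul, ih _ (by omega)]

lemma schurChain_zero_last (k : ℕ) {n : ℕ} (hn : n < N) :
    schurChain γ N k n ⟨0, by omega⟩ ⟨n, hn⟩ =
      ∏ i ∈ Finset.range n, (defect (γ k (k + i + 1)) : ℂ) := by
  induction n with
  | zero => simp [schurChain]
  | succ n ih =>
    rw [schurChain, mul_apply_eq_rowAct, rowAct_schurRotation_snd _ hn, ih (by omega),
      schurChain_apply_of_lt_col _ _ _ (by simp), Matrix.one_apply_ne (by simp [Fin.ext_iff]),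
      Finset.prod_range_succ]
    simp [mul_comm]

/-- Isolates the newest parameter: the corner entry is affine in γ_{k,k+n+1}, and all other
quantities involve only parameters with a smaller index gap. The defect in column n + 1 of the chain
does not contribute, since it meets a zero of the second factor. -/
lemma latticeU_succ_zero_zero (k : ℕ) {n : ℕ} (hn : n + 1 < N) :
    latticeU γ N k (n + 1) ⟨0, by omega⟩ ⟨0, by omega⟩ =
      (∑ s : Fin N, if s.val < n then schurChain γ N k n ⟨0, by omega⟩ s *
        latticeU γ N (k + 1) n s ⟨0, by omega⟩ else 0) +
      schurChain γ N k n ⟨0, by omega⟩ ⟨n, by omega⟩ * γ k (k + n + 1) *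
        latticeU γ N (k + 1) n ⟨n, by omega⟩ ⟨0, by omega⟩ := by
  rw [latticeU, Matrix.mul_apply]
  have : ∀ s : Fin N, schurChain γ N k (n + 1) ⟨0, by omega⟩ s *
      latticeU γ N (k + 1) n s ⟨0, by omega⟩ =
      (if s.val < n then schurChain γ N k n ⟨0, by omega⟩ s *
        latticeU γ N (k + 1) n s ⟨0, by omega⟩ else 0) +
      if s = ⟨n, by omega⟩ then schurChain γ N k n ⟨0, by omega⟩ ⟨n, by omega⟩ * γ k (k + n + 1) *
        latticeU γ N (k + 1) n ⟨n, by omega⟩ ⟨0, by omega⟩ else 0 := by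
    intro s
    rcases lt_trichotomy s.val n with h | h | h
    · rw [if_pos h, if_neg (Fin.ne_of_val_ne (by simp; omega)), add_zero, schurChain,
        mul_apply_eq_rowAct, rowAct_schurRotation_of_ne _ _ _ _ (by omega) (by omega)]
    · obtain rfl : s = ⟨n, Nat.lt_of_succ_lt hn⟩ := Fin.ext h
      rw [if_neg (by simp), if_pos rfl, schurChain, mul_apply_eq_rowAct,
        rowAct_schurRotation_fst _ hn,
        schurChain_apply_of_lt_col (n := n) _ _ ⟨n + 1, hn⟩ (by simp),
        Matrix.one_apply_ne (by simp [Fin.ext_iff])]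
      simp [mul_comm]
    · rw [if_neg (by omega), if_neg (Fin.ne_of_val_ne (by simp; omega)),
        latticeU_apply_of_lt_row _ s _ h, Matrix.one_apply_ne (Fin.ne_of_val_ne (by simp; omega))]
      simp
  simp only [this, Finset.sum_add_distrib]
  simp

/-- The only path from the last row to column 0 moves one coordinate per chain, and each move
contributes a defect. -/
lemma latticeU_last_zero_ne_zero (hγ : ∀ k j, k < j → ‖γ k j‖ < 1) (k : ℕ) {n : ℕ} (hn : n < N) :
    latticeU γ N k n ⟨n, hn⟩ ⟨0, by omega⟩ ≠ 0 := by
  induction n generalizing k with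
  | zero => simp [latticeU]
  | succ n ih =>
    rw [latticeU, Matrix.mul_apply, Finset.sum_eq_single ⟨n, by omega⟩]
    · refine mul_ne_zero ?_ (ih _ _)
      rw [schurChain, mul_apply_eq_rowAct, rowAct_schurRotation_fst _ hn,
        schurChain_apply_of_lt_row _ _ _ (by simp), schurChain_apply_of_lt_row _ _ _ (by simp),
        Matrix.one_apply_ne (by simp [Fin.ext_iff])]
      simpa using (defect_pos (hγ k (k + n + 1) (by omega))).ne'
    · intro s _ hs
      rcases lt_or_gt_of_ne (fun h => hs (Fin.ext h) : s.val ≠ n) with h | h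
      · rw [schurChain, mul_apply_eq_rowAct,
          rowAct_schurRotation_of_ne _ _ _ _ (by omega) (by omega),
          schurChain_apply_of_lt_row _ _ _ (by simp),
          Matrix.one_apply_ne (Fin.ne_of_val_ne (by simp; omega)), zero_mul]
      · rw [latticeU_apply_of_lt_row _ s _ h,
          Matrix.one_apply_ne (Fin.ne_of_val_ne (by simp; omega)), mul_zero]
    · simp

lemma schurChain_congr (k n : ℕ) (h : ∀ i < n, γ k (k + i + 1) = γ' k (k + i + 1)) :
    schurChain γ N k n = schurChain γ' N k n := by
  induction n with
  | zero => rfl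
  | succ n ih => rw [schurChain, schurChain, ih fun i hi => h i (by omega), h n (by omega)]

lemma latticeU_congr (k n : ℕ) (h : ∀ a, ∀ i < n, γ a (a + i + 1) = γ' a (a + i + 1)) :
    latticeU γ N k n = latticeU γ' N k n := by
  induction n generalizing k with
  | zero => rw [latticeU, latticeU]
  | succ n ih =>
    rw [latticeU, latticeU, schurChain_congr k _ (h k), ih _ fun a i hi => h a i (by omega)]

/-- A kernel with positive diagonal has at most one family of parameters. -/
theorem IsParameterFamily.unique {K : Matrix ℕ ℕ ℂ} (hK : ∀ k, 0 < (K k k).re)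
    (h : IsParameterFamily K γ) (h' : IsParameterFamily K γ') : γ = γ' := by
  -- Strong induction on the gap: once smaller gaps agree, the two affine expressions for the corner
  -- entry have the same constant term and the same nonzero slope.
  have key : ∀ n k, γ k (k + n + 1) = γ' k (k + n + 1) := by
    intro n
    induction n using Nat.strong_induction_on with
    | _ n ih =>
      intro k
      have e := (h.kernel_eq k (n + 1)).symm.trans (h'.kernel_eq k (n + 1))
      have pos : ∀ k, (Real.sqrt (K k k).re : ℂ) ≠ 0 := fun k => by
        exact_mod_cast (Real.sqrt_pos.2 (hK k)).ne'
      have e' := mul_left_cancel₀ (pos _) (mul_right_cancel₀ (pos _) e)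
      have e1 := latticeU_succ_zero_zero (γ := γ) k (n + 1).lt_succ_self
      have e2 := latticeU_succ_zero_zero (γ := γ') k (n + 1).lt_succ_self
      rw [schurChain_congr (γ := γ) (γ' := γ') k n fun i hi => ih i hi k,
        latticeU_congr (γ := γ) (γ' := γ') (k + 1) n fun a i hi => ih i hi a] at e1
      have e3 := add_left_cancel (e1.symm.trans (e'.trans e2))
      refine mul_left_cancel₀ ?_ (mul_right_cancel₀
        (latticeU_last_zero_ne_zero h'.norm_lt_one (k + 1) (by omega)) e3)
      rw [schurChain_zero_last]
      exact Finset.prod_ne_zero_iff.2 fun i _ => by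
        exact_mod_cast (defect_pos (h'.norm_lt_one k _ (by omega))).ne'
  funext k j
  rcases lt_or_ge k j with hkj | hkj
  · obtain ⟨n, rfl⟩ := Nat.exists_eq_add_of_lt hkj
    exact key n k
  · rw [h.eq_zero _ _ hkj, h'.eq_zero _ _ hkj]

end Rotations

/-! ### Forward and backward residuals of a sequence of vectors -/

section Residuals

variable {H : Type*} [NormedAddCommGroup H] [InnerProductSpace ℂ H]

lemma norm_sub_inner_smul_sq {f g : H} (hf : ‖f‖ = 1) (hg : ‖g‖ = 1) :
    ‖f - inner ℂ g f • g‖ ^ 2 = 1 - ‖inner ℂ g f‖ ^ 2 := by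
  have h := norm_sub_sq (𝕜 := ℂ) f (inner ℂ g f • g)
  rw [inner_smul_right, norm_smul, hf, hg] at h
  have h' : RCLike.re (inner ℂ g f * inner ℂ f g) = ‖inner ℂ g f‖ ^ 2 := by
    rw [← inner_conj_symm f g, RCLike.mul_conj]
    norm_cast
  rw [h'] at h
  rw [h]
  ring

lemma norm_inv_defect_smul {f g : H} (hf : ‖f‖ = 1) (hg : ‖g‖ = 1) (h : ‖inner ℂ g f‖ < 1) :
    ‖((defect (inner ℂ g f))⁻¹ : ℂ) • (f - inner ℂ g f • g)‖ = 1 := by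
  have hd := defect_pos h
  have : ‖f - inner ℂ g f • g‖ = defect (inner ℂ g f) := by
    rw [← sq_eq_sq₀ (norm_nonneg _) hd.le, norm_sub_inner_smul_sq hf hg, defect_sq h]
  rw [norm_smul, this, norm_inv, Complex.norm_real, Real.norm_of_nonneg hd.le,
    inv_mul_cancel₀ (ne_of_gt hd)]

/-- The normalized residuals of `v (l + n)` modulo `v l, …, v (l + n - 1)` and of `v l` modulo
`v (l + 1), …, v (l + n)`, by the lattice recursion on `n`. -/
def residualPair (v : ℕ → H) : ℕ → ℕ → H × H
  | 0, l => ((‖v l‖⁻¹ : ℂ) • v l, (‖v l‖⁻¹ : ℂ) • v l)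
  | n + 1, l =>
    let f := (residualPair v n (l + 1)).1
    let g := (residualPair v n l).2
    let γ := inner ℂ g f
    (((defect γ)⁻¹ : ℂ) • (f - γ • g), ((defect γ)⁻¹ : ℂ) • (g - conj γ • f))

/-- The normalized residual of `v (l + n)` modulo `v l, …, v (l + n - 1)`. -/
def forward (v : ℕ → H) (n l : ℕ) : H := (residualPair v n l).1

/-- The normalized residual of `v l` modulo `v (l + 1), …, v (l + n)`. -/
def backward (v : ℕ → H) (n l : ℕ) : H := (residualPair v n l).2

/-- The parameter `γ_{l,l+n+1}`. -/
def reflection (v : ℕ → H) (n l : ℕ) : ℂ := inner ℂ (backward v n l) (forward v n (l + 1))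

lemma forward_zero (v : ℕ → H) (l : ℕ) : forward v 0 l = (‖v l‖⁻¹ : ℂ) • v l := by
  rw [forward, residualPair]

lemma backward_zero (v : ℕ → H) (l : ℕ) : backward v 0 l = (‖v l‖⁻¹ : ℂ) • v l := by
  rw [backward, residualPair]

lemma forward_succ (v : ℕ → H) (n l : ℕ) : forward v (n + 1) l =
    ((defect (reflection v n l))⁻¹ : ℂ) •
      (forward v n (l + 1) - reflection v n l • backward v n l) := by
  rw [forward, residualPair]
  rfl

lemma backward_succ (v : ℕ → H) (n l : ℕ) : backward v (n + 1) l =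
    ((defect (reflection v n l))⁻¹ : ℂ) •
      (backward v n l - conj (reflection v n l) • forward v n (l + 1)) := by
  rw [backward, residualPair]
  rfl

/-- The norm of the residual of `v l` modulo `v (l + 1), …, v (l + n)`. -/
def residualNorm (v : ℕ → H) (n l : ℕ) : ℝ :=
  ‖v l‖ * ∏ i ∈ Finset.range n, defect (reflection v i l)

/-- The defining properties of the normalized residuals. -/
structure IsResidual (v : ℕ → H) (n l : ℕ) : Prop where
  norm_forward : ‖forward v n l‖ = 1
  norm_backward : ‖backward v n l‖ = 1
  residualNorm_pos : 0 < residualNorm v n l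
  forward_sub_mem : ∃ a : ℂ, a ≠ 0 ∧
    forward v n l - a • v (l + n) ∈ Submodule.span ℂ (v '' Set.Ico l (l + n))
  backward_sub_mem : backward v n l - ((residualNorm v n l)⁻¹ : ℂ) • v l ∈
    Submodule.span ℂ (v '' Set.Ioc l (l + n))
  inner_forward : ∀ i ∈ Set.Ico l (l + n), inner ℂ (v i) (forward v n l) = 0
  inner_backward : ∀ i ∈ Set.Ioc l (l + n), inner ℂ (v i) (backward v n l) = 0

lemma inner_eq_zero_of_mem_span {s : Set ℕ} {v : ℕ → H} {x y : H}
    (h : ∀ i ∈ s, inner ℂ (v i) x = 0) (hy : y ∈ Submodule.span ℂ (v '' s)) :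
    inner ℂ y x = 0 := by
  have : Submodule.span ℂ (v '' s) ≤ (ℂ ∙ x)ᗮ := by
    rw [Submodule.span_le]
    rintro _ ⟨i, hi, rfl⟩
    exact (Submodule.mem_orthogonal_singleton_iff_inner_left).2 (h i hi)
  exact (Submodule.mem_orthogonal_singleton_iff_inner_left).1 (this hy)

variable {v : ℕ → H}

lemma span_image_mono {s t : Set ℕ} (h : s ⊆ t) :
    Submodule.span ℂ (v '' s) ≤ Submodule.span ℂ (v '' t) :=
  Submodule.span_mono (Set.image_mono h)

lemma mem_span_image {s : Set ℕ} {i : ℕ} (hi : i ∈ s) : v i ∈ Submodule.span ℂ (v '' s) :=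
  Submodule.subset_span ⟨i, hi, rfl⟩

lemma IsResidual.forward_mem {n l : ℕ} (h : IsResidual v n l) :
    forward v n l ∈ Submodule.span ℂ (v '' Set.Icc l (l + n)) := by
  obtain ⟨a, -, ha⟩ := h.forward_sub_mem
  rw [← sub_add_cancel (forward v n l) (a • v (l + n))]
  exact Submodule.add_mem _ (span_image_mono Set.Ico_subset_Icc_self ha)
    (Submodule.smul_mem _ _ (mem_span_image (by simp)))

lemma IsResidual.backward_mem {n l : ℕ} (h : IsResidual v n l) :
    backward v n l ∈ Submodule.span ℂ (v '' Set.Icc l (l + n)) := by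
  rw [← sub_add_cancel (backward v n l) (((residualNorm v n l)⁻¹ : ℂ) • v l)]
  exact Submodule.add_mem _ (span_image_mono Set.Ioc_subset_Icc_self h.backward_sub_mem)
    (Submodule.smul_mem _ _ (mem_span_image (by simp)))

/-- Equality in Cauchy-Schwarz would make f_{n,l+1} a multiple of g_{n,l}, and v_{l+1+n} would then
lie in the span of earlier vectors. -/
lemma norm_reflection_lt_one_of_isResidual (hv : LinearIndependent ℂ v) {n l : ℕ}
    (h : IsResidual v n l) (h' : IsResidual v n (l + 1)) : ‖reflection v n l‖ < 1 := by
  by_contra hγ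
  have hsq := norm_sub_inner_smul_sq h'.norm_forward h.norm_backward
  change ‖_ - reflection v n l • _‖ ^ 2 = 1 - ‖reflection v n l‖ ^ 2 at hsq
  have h0 : forward v n (l + 1) - reflection v n l • backward v n l = 0 := by
    rw [← norm_eq_zero, ← sq_eq_zero_iff]
    exact le_antisymm (by nlinarith) (sq_nonneg _)
  rw [sub_eq_zero] at h0
  obtain ⟨a, ha, hmem⟩ := h'.forward_sub_mem
  refine hv.notMem_span_image (s := Set.Iio (l + 1 + n)) (x := l + 1 + n) (by simp) ?_
  rw [← Submodule.smul_mem_iff _ ha,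
    ← sub_sub_cancel (forward v n (l + 1)) (a • v (l + 1 + n)), h0]
  refine Submodule.sub_mem _ (Submodule.smul_mem _ _ (span_image_mono ?_ h.backward_mem))
    (span_image_mono ?_ (h0 ▸ hmem))
  · intro i hi
    simp only [Set.mem_Icc, Set.mem_Iio] at *
    omega
  · intro i hi
    simp only [Set.mem_Ico, Set.mem_Iio] at *
    omega

lemma defect_conj (g : ℂ) : defect (conj g) = defect g := by simp [defect]

lemma conj_reflection (n l : ℕ) :
    conj (reflection v n l) = inner ℂ (forward v n (l + 1)) (backward v n l) :=
  inner_conj_symm _ _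

/-- One Gram-Schmidt step for the pair g_{n,l}, f_{n,l+1}. Orthogonality to v_{l+1}, …, v_{l+n} is
inherited; only orthogonality to one end vector is new, v_l for the forward and v_{l+n+1} for the
backward residual. -/
lemma IsResidual.succ (hv : LinearIndependent ℂ v) {n l : ℕ}
    (h : IsResidual v n l) (h' : IsResidual v n (l + 1)) : IsResidual v (n + 1) l := by
  have hγ := norm_reflection_lt_one_of_isResidual hv h h'
  have hd := defect_pos hγ
  have hd' : ((defect (reflection v n l))⁻¹ : ℂ) ≠ 0 := by
    exact_mod_cast inv_ne_zero hd.ne'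
  have hres : residualNorm v (n + 1) l = residualNorm v n l * defect (reflection v n l) := by
    rw [residualNorm, Finset.prod_range_succ, residualNorm, mul_assoc]
  have hpos : 0 < residualNorm v (n + 1) l := hres ▸ mul_pos h.residualNorm_pos hd
  have hcg : forward v n (l + 1) ∈ Submodule.span ℂ (v '' Set.Ioc l (l + (n + 1))) :=
    span_image_mono (fun i hi => by
      simp only [Set.mem_Ioc, Set.mem_Icc] at *; omega) h'.forward_mem
  have hcf : backward v n l ∈ Submodule.span ℂ (v '' Set.Ico l (l + (n + 1))) :=
    span_image_mono (fun i hi => by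
      simp only [Set.mem_Ico, Set.mem_Icc] at *; omega) h.backward_mem
  refine ⟨?_, ?_, hpos, ?_, ?_, ?_, ?_⟩
  · rw [forward_succ]
    exact norm_inv_defect_smul h'.norm_forward h.norm_backward hγ
  · rw [backward_succ, ← defect_conj, conj_reflection]
    refine norm_inv_defect_smul h.norm_backward h'.norm_forward ?_
    rw [← conj_reflection, RCLike.norm_conj]
    exact hγ
  · obtain ⟨a, ha, hmem⟩ := h'.forward_sub_mem
    refine ⟨((defect (reflection v n l))⁻¹ : ℂ) * a, mul_ne_zero hd' ha, ?_⟩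
    rw [forward_succ, mul_smul, ← smul_sub, sub_right_comm, show l + (n + 1) = l + 1 + n by omega]
    refine Submodule.smul_mem _ _ (Submodule.sub_mem _ (span_image_mono ?_ hmem)
      (Submodule.smul_mem _ _ (by convert hcf using 4; omega)))
    intro i hi
    simp only [Set.mem_Ico] at *
    omega
  · have : ((residualNorm v (n + 1) l)⁻¹ : ℂ) =
        ((defect (reflection v n l))⁻¹ : ℂ) * ((residualNorm v n l)⁻¹ : ℂ) := by
      rw [hres]
      push_cast
      rw [mul_inv, mul_comm]
    rw [backward_succ, this, mul_smul, ← smul_sub, sub_right_comm]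
    refine Submodule.smul_mem _ _ (Submodule.sub_mem _ (span_image_mono ?_ h.backward_sub_mem)
      (Submodule.smul_mem _ _ hcg))
    intro i hi
    simp only [Set.mem_Ioc] at *
    omega
  · intro i hi
    rw [forward_succ, inner_smul_right, inner_sub_right, inner_smul_right]
    rcases hi.1.eq_or_lt with rfl | hi'
    · have horth : inner ℂ (backward v n l) (forward v n (l + 1) -
          reflection v n l • backward v n l) = 0 := by
        rw [inner_sub_right, inner_smul_right, inner_self_eq_norm_sq_to_K, h.norm_backward]
        simp [reflection]
      have hrest : inner ℂ (backward v n l - ((residualNorm v n l)⁻¹ : ℂ) • v l)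
          (forward v n (l + 1) - reflection v n l • backward v n l) = 0 := by
        refine inner_eq_zero_of_mem_span (fun i hi => ?_) h.backward_sub_mem
        rw [inner_sub_right, inner_smul_right, h.inner_backward i hi, h'.inner_forward i ?_]
        · simp
        · simp only [Set.mem_Ico, Set.mem_Ioc] at *
          omega
      rw [inner_sub_left, horth, zero_sub, neg_eq_zero, inner_smul_left, mul_eq_zero] at hrest
      rcases hrest with hrest | hrest
      · have := h.residualNorm_pos.ne'
        simp [this] at hrest
      · rw [inner_sub_right, inner_smul_right] at hrest
        rw [hrest, mul_zero]
    · simp only [Set.mem_Ico] at hi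
      rw [h'.inner_forward i ⟨by omega, by omega⟩, h.inner_backward i ⟨hi', by omega⟩]
      simp
  · intro i hi
    simp only [Set.mem_Ioc] at hi
    rw [backward_succ, inner_smul_right, inner_sub_right, inner_smul_right]
    rcases hi.2.eq_or_lt with rfl | hi'
    · have horth : inner ℂ (forward v n (l + 1)) (backward v n l -
          conj (reflection v n l) • forward v n (l + 1)) = 0 := by
        rw [inner_sub_right, inner_smul_right, inner_self_eq_norm_sq_to_K, h'.norm_forward]
        simp [conj_reflection]
      obtain ⟨a, ha, hmem⟩ := h'.forward_sub_mem
      have hrest : inner ℂ (forward v n (l + 1) - a • v (l + 1 + n))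
          (backward v n l - conj (reflection v n l) • forward v n (l + 1)) = 0 := by
        refine inner_eq_zero_of_mem_span (fun i hi => ?_) hmem
        rw [inner_sub_right, inner_smul_right, h'.inner_forward i hi, h.inner_backward i ?_]
        · simp
        · simp only [Set.mem_Ico, Set.mem_Ioc] at *
          omega
      rw [inner_sub_left, horth, zero_sub, neg_eq_zero, inner_smul_left, mul_eq_zero] at hrest
      rcases hrest with hrest | hrest
      · simp [ha] at hrest
      · rw [inner_sub_right, inner_smul_right] at hrest
        rw [show l + (n + 1) = l + 1 + n by omega, hrest, mul_zero]
    · rw [h'.inner_forward i ⟨by omega, by omega⟩, h.inner_backward i ⟨hi.1, by omega⟩]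
      simp

theorem isResidual (hv : LinearIndependent ℂ v) (n l : ℕ) : IsResidual v n l := by
  induction n generalizing l with
  | zero =>
    have h0 : 0 < ‖v l‖ := norm_pos_iff.2 (hv.ne_zero l)
    have h0' : (‖v l‖ : ℂ) ≠ 0 := by exact_mod_cast h0.ne'
    refine ⟨?_, ?_, ?_, ⟨(‖v l‖⁻¹ : ℂ), inv_ne_zero h0', ?_⟩, ?_, by simp, by simp⟩
    · rw [forward_zero, norm_smul, norm_inv, Complex.norm_real, norm_norm, inv_mul_cancel₀ h0.ne']
    · rw [backward_zero, norm_smul, norm_inv, Complex.norm_real, norm_norm, inv_mul_cancel₀ h0.ne']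
    · simpa [residualNorm] using h0
    · simp [forward_zero]
    · simp [backward_zero, residualNorm]
  | succ n ih => exact (ih l).succ hv (ih (l + 1))

lemma norm_reflection_lt_one (hv : LinearIndependent ℂ v) (n l : ℕ) : ‖reflection v n l‖ < 1 :=
  norm_reflection_lt_one_of_isResidual hv (isResidual hv n l) (isResidual hv n (l + 1))

/-- The recursion solved for f_{n,l+1} in terms of g_{n,l} and f_{n+1,l}. Together with
`backward_succ_eq` its coefficients are the two columns of the rotation block. -/
lemma forward_shift_eq (hv : LinearIndependent ℂ v) (n l : ℕ) : forward v n (l + 1) =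
    reflection v n l • backward v n l + (defect (reflection v n l) : ℂ) • forward v (n + 1) l := by
  have hd : (defect (reflection v n l) : ℂ) ≠ 0 := by
    exact_mod_cast (defect_pos (norm_reflection_lt_one hv n l)).ne'
  rw [forward_succ, smul_inv_smul₀ hd, add_sub_cancel]

lemma backward_succ_eq (hv : LinearIndependent ℂ v) (n l : ℕ) : backward v (n + 1) l =
    (defect (reflection v n l) : ℂ) • backward v n l -
      conj (reflection v n l) • forward v (n + 1) l := by
  have hγ := norm_reflection_lt_one hv n l
  have hd : (defect (reflection v n l) : ℂ) ≠ 0 := by exact_mod_cast (defect_pos hγ).ne'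
  have hsq : (defect (reflection v n l) : ℂ) ^ 2 =
      1 - reflection v n l * conj (reflection v n l) := by
    rw [Complex.mul_conj, Complex.normSq_eq_norm_sq]
    exact_mod_cast defect_sq hγ
  refine smul_right_injective _ hd ?_
  dsimp only
  rw [backward_succ, smul_inv_smul₀ hd, smul_sub, smul_smul, smul_comm, forward_succ,
    smul_inv_smul₀ hd, ← sq, hsq]
  module

/-! ### Existence of the parameters -/

/-- The family of parameters of the Gram matrix of `v`. -/
def reflectionFamily (v : ℕ → H) (k j : ℕ) : ℂ :=
  if k < j then reflection v (j - k - 1) k else 0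

lemma reflectionFamily_add (k n : ℕ) : reflectionFamily v k (k + n + 1) = reflection v n k := by
  rw [reflectionFamily, if_pos (by omega), show k + n + 1 - k - 1 = n by omega]

/-- The rotation with parameter γ_{k,k+m+1} turns the adjacent pair (g_{m,k}, f_{m+1,k}) into
(f_{m,k+1}, g_{m+1,k}). The chain starts from f_{0,k} = g_{0,k} and carries the backward residual
along the row. -/
lemma rowAct_schurChain (hv : LinearIndependent ℂ v) {N k n : ℕ} (hn : n < N) {W : Fin N → H}
    (hW : ∀ i : Fin N, i.val ≤ n → W i = forward v i k) {m : ℕ} (hm : m ≤ n) (i : Fin N)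
    (hi : i.val ≤ n) :
    rowAct W (schurChain (reflectionFamily v) N k m) i =
      if i.val < m then forward v i (k + 1) else if i.val = m then backward v m k
        else forward v i k := by
  induction m generalizing i with
  | zero =>
    rw [schurChain, rowAct_one, hW i hi, if_neg (by omega)]
    split_ifs with h
    · rw [h, forward_zero, backward_zero]
    · rfl
  | succ m ih =>
    rw [schurChain, rowAct_mul, reflectionFamily_add]
    have hN : m + 1 < N := by omega
    by_cases h : i.val = m
    · obtain rfl : i = ⟨m, Nat.lt_of_succ_lt hN⟩ := Fin.ext h
      rw [rowAct_schurRotation_fst _ hN, ih (by omega) _ (by simp; omega),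
        ih (by omega) _ (by simp; omega)]
      simp [forward_shift_eq hv]
    by_cases h' : i.val = m + 1
    · obtain rfl : i = ⟨m + 1, hN⟩ := Fin.ext h'
      rw [rowAct_schurRotation_snd _ hN, ih (by omega) _ (by simp; omega),
        ih (by omega) _ (by simp; omega)]
      simp [backward_succ_eq hv]
    rw [rowAct_schurRotation_of_ne _ _ _ _ h h', ih (by omega) _ hi, if_neg h, if_neg h']
    exact if_congr (by omega) rfl rfl

/-- Each chain replaces the residuals based at k by those based at k + 1, so after all of them the
first place holds v_{k+n} normalized. -/
lemma rowAct_latticeU (hv : LinearIndependent ℂ v) {N k n : ℕ} (hn : n < N) {W : Fin N → H}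
    (hW : ∀ i : Fin N, i.val ≤ n → W i = forward v i k) :
    rowAct W (latticeU (reflectionFamily v) N k n) ⟨0, by omega⟩ = forward v 0 (k + n) := by
  induction n generalizing k W with
  | zero => rw [latticeU, rowAct_one, hW _ le_rfl, add_zero]
  | succ n ih =>
    rw [latticeU, rowAct_mul, ih (k := k + 1) (by omega), show k + 1 + n = k + (n + 1) by omega]
    intro i hi
    rw [rowAct_schurChain hv hn hW le_rfl i (by omega), if_pos (by omega)]

lemma forward_orthonormal (hv : LinearIndependent ℂ v) (l : ℕ) :
    Orthonormal ℂ fun n => forward v n l := by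
  refine ⟨fun n => (isResidual hv n l).norm_forward, ?_⟩
  have key : ∀ m n, m < n → inner ℂ (forward v m l) (forward v n l) = 0 := fun m n hmn => by
    refine inner_eq_zero_of_mem_span (fun i hi => (isResidual hv n l).inner_forward i ?_)
      (isResidual hv m l).forward_mem
    simp only [Set.mem_Icc, Set.mem_Ico] at *
    omega
  intro m n hmn
  rcases lt_or_gt_of_ne hmn with h | h
  · exact key m n h
  · exact inner_eq_zero_symm.1 (key n m h)

lemma sqrt_gram {K : Matrix ℕ ℕ ℂ} (hK : ∀ k j, inner ℂ (v k) (v j) = K k j) (k : ℕ) :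
    Real.sqrt (K k k).re = ‖v k‖ := by
  rw [← hK, norm_eq_sqrt_re_inner (𝕜 := ℂ)]
  rfl

/-- The Gram matrix of a linearly independent sequence has a family of parameters. -/
theorem isParameterFamily_reflectionFamily (hv : LinearIndependent ℂ v) {K : Matrix ℕ ℕ ℂ}
    (hK : ∀ k j, inner ℂ (v k) (v j) = K k j) : IsParameterFamily K (reflectionFamily v) := by
  refine ⟨fun k j hkj => ?_, fun k j hkj => if_neg (by omega), fun k n => ?_⟩
  · rw [reflectionFamily, if_pos hkj]
    exact norm_reflection_lt_one hv _ _
  have hn0 : ∀ k, (‖v k‖ : ℂ) ≠ 0 := fun k => by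
    exact_mod_cast (norm_pos_iff.2 (hv.ne_zero k)).ne'
  have hU := rowAct_latticeU hv (N := n + 1) (k := k) (n := n) (by omega)
    (W := fun i => forward v i k) fun i _ => rfl
  -- The f_{i,k} are orthonormal, so pairing with f_{0,k} extracts the corner entry of the matrix.
  have hU' := congrArg (inner ℂ (forward v 0 k)) hU
  simp only [rowAct, inner_sum, inner_smul_right,
    orthonormal_iff_ite.1 (forward_orthonormal hv k)] at hU'
  rw [Finset.sum_eq_single 0] at hU'
  · simp only [Fin.val_zero, if_true, mul_one, forward_zero, inner_smul_left, inner_smul_right,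
      hK] at hU'
    rw [sqrt_gram hK, sqrt_gram hK]
    change latticeU (reflectionFamily v) (n + 1) k n 0 0 = _ at hU'
    rw [hU']
    have h1 := hn0 k
    have h2 := hn0 (k + n)
    simp only [map_inv₀, Complex.conj_ofReal]
    field_simp
  · intro i _ hi
    rw [if_neg fun h => hi (Fin.ext h.symm), mul_zero]
  · simp

end Residuals

/-! ### Polynomials as vectors -/

section PolyVec

variable {H : Type*} [NormedAddCommGroup H] [InnerProductSpace ℂ H]

/-- The vector `∑ p_i v (i + l)`. -/
def polyVec (v : ℕ → H) (l : ℕ) : ℂ[X] →ₗ[ℂ] H :=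
  Polynomial.lsum fun i => LinearMap.toSpanSingleton ℂ H (v (i + l))

lemma polyVec_apply (v : ℕ → H) (l : ℕ) (P : ℂ[X]) :
    polyVec v l P = P.sum fun i a => a • v (i + l) := rfl

lemma polyVec_monomial (v : ℕ → H) (l i : ℕ) (a : ℂ) :
    polyVec v l (monomial i a) = a • v (i + l) := by
  rw [polyVec_apply, sum_monomial_index _ _ (by simp)]

lemma polyVec_C (v : ℕ → H) (l : ℕ) (a : ℂ) : polyVec v l (C a) = a • v l := by
  rw [← monomial_zero_left, polyVec_monomial, zero_add]

lemma polyVec_C_mul (v : ℕ → H) (l : ℕ) (a : ℂ) (P : ℂ[X]) :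
    polyVec v l (C a * P) = a • polyVec v l P := by
  rw [← smul_eq_C_mul, map_smul]

lemma polyVec_X_mul (v : ℕ → H) (l : ℕ) (P : ℂ[X]) :
    polyVec v l (X * P) = polyVec v (l + 1) P := by
  induction P using Polynomial.induction_on' with
  | add p q hp hq => rw [mul_add, map_add, map_add, hp, hq]
  | monomial i a =>
    rw [X_mul_monomial, polyVec_monomial, polyVec_monomial, add_right_comm, add_assoc]

variable {v : ℕ → H} {K : Matrix ℕ ℕ ℂ}

lemma inner_polyVec (hK : ∀ k j, inner ℂ (v k) (v j) = K k j) (l : ℕ) (P Q : ℂ[X]) :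
    inner ℂ (polyVec v l Q) (polyVec v l P) = polyInner (shiftKernel K l) P Q := by
  simp only [polyVec_apply, polyInner, Polynomial.sum, sum_inner, inner_sum, inner_smul_left,
    inner_smul_right, hK, shiftKernel, Matrix.of_apply, Finset.mul_sum]
  refine Finset.sum_congr rfl fun i _ => Finset.sum_congr rfl fun j _ => ?_
  ring

/-- Multiplication by X becomes the shift of the base index, which identifies the polynomial
recursion with that of the residuals. -/
lemma polyVec_polyPair (hK : ∀ k j, inner ℂ (v k) (v j) = K k j) (n l : ℕ) :
    polyVec v l (orthPoly K (reflectionFamily v) n l) = forward v n l ∧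
      polyVec v l (orthPolySharp K (reflectionFamily v) n l) = backward v n l := by
  induction n generalizing l with
  | zero =>
    rw [orthPoly, orthPolySharp, polyPair, forward_zero, backward_zero, polyVec_C, sqrt_gram hK]
    push_cast
    exact ⟨rfl, rfl⟩
  | succ n ih =>
    have hf := (ih (l + 1)).1
    have hg := (ih l).2
    rw [orthPoly] at hf
    rw [orthPolySharp] at hg
    rw [orthPoly, orthPolySharp, polyPair, forward_succ, backward_succ,
      show n + 1 + l = l + n + 1 by omega, reflectionFamily_add]
    dsimp only
    rw [polyVec_C_mul, polyVec_C_mul, map_sub, map_add, polyVec_X_mul, polyVec_C_mul, hg, hf,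
      ← C_neg, mul_assoc, polyVec_C_mul, polyVec_X_mul, hf]
    push_cast
    refine ⟨rfl, ?_⟩
    rw [neg_smul, neg_add_eq_sub]

end PolyVec

lemma natDegree_polyPair_le (K : Matrix ℕ ℕ ℂ) (γ : ℕ → ℕ → ℂ) (n l : ℕ) :
    (orthPoly K γ n l).natDegree ≤ n ∧ (orthPolySharp K γ n l).natDegree ≤ n := by
  induction n generalizing l with
  | zero => simp [orthPoly, orthPolySharp, polyPair]
  | succ n ih =>
    have hf := (ih (l + 1)).1
    have hg := (ih l).2
    rw [orthPoly] at hf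
    rw [orthPolySharp] at hg
    have hX : (X * (polyPair K γ n (l + 1)).1).natDegree ≤ n + 1 := by
      refine natDegree_mul_le.trans ?_
      rw [natDegree_X]
      omega
    rw [orthPoly, orthPolySharp, polyPair]
    dsimp only
    rw [← C_neg, mul_assoc (C _) X]
    constructor
    · refine (natDegree_C_mul_le _ _).trans ((natDegree_sub_le _ _).trans (max_le hX ?_))
      exact (natDegree_C_mul_le _ _).trans (hg.trans n.le_succ)
    · refine (natDegree_C_mul_le _ _).trans ((natDegree_add_le _ _).trans (max_le ?_ ?_))
      · exact (natDegree_C_mul_le _ _).trans hX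
      · exact hg.trans n.le_succ

lemma coeff_orthPoly_pos {K : Matrix ℕ ℕ ℂ} {γ : ℕ → ℕ → ℂ} (hK : ∀ k, 0 < (K k k).re)
    (hγ : ∀ k j, k < j → ‖γ k j‖ < 1) (n l : ℕ) : 0 < (orthPoly K γ n l).coeff n := by
  induction n generalizing l with
  | zero =>
    simp only [orthPoly, polyPair, coeff_C_zero]
    exact_mod_cast inv_pos.2 (Real.sqrt_pos.2 (hK l))
  | succ n ih =>
    have hf := ih (l + 1)
    have hg : (orthPolySharp K γ n l).coeff (n + 1) = 0 :=
      coeff_eq_zero_of_natDegree_lt (Nat.lt_succ_of_le (natDegree_polyPair_le K γ n l).2)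
    rw [orthPoly] at hf
    rw [orthPolySharp] at hg
    rw [orthPoly, polyPair]
    dsimp only
    rw [coeff_C_mul, coeff_sub, coeff_X_mul, coeff_C_mul, hg, mul_zero, sub_zero]
    refine mul_pos ?_ hf
    exact_mod_cast inv_pos.2 (defect_pos (hγ l _ (by omega)))

lemma coeff_zero_orthPolySharp_ne_zero {K : Matrix ℕ ℕ ℂ} {γ : ℕ → ℕ → ℂ}
    (hK : ∀ k, 0 < (K k k).re) (hγ : ∀ k j, k < j → ‖γ k j‖ < 1) (n l : ℕ) :
    (orthPolySharp K γ n l).coeff 0 ≠ 0 := by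
  induction n generalizing l with
  | zero =>
    simp only [orthPolySharp, polyPair, coeff_C_zero]
    exact_mod_cast inv_ne_zero (Real.sqrt_pos.2 (hK l)).ne'
  | succ n ih =>
    have hg := ih l
    rw [orthPolySharp] at hg
    rw [orthPolySharp, polyPair]
    dsimp only
    rw [coeff_C_mul, coeff_add, ← C_neg, mul_assoc, coeff_C_mul, coeff_X_mul_zero, mul_zero,
      zero_add]
    refine mul_ne_zero ?_ hg
    exact_mod_cast inv_ne_zero (defect_pos (hγ l _ (by omega))).ne'

lemma isUnit_arrayPhiSharp {K : Matrix ℕ ℕ ℂ} {γ : ℕ → ℕ → ℂ}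
    (hK : ∀ k, 0 < (K k k).re) (hγ : ∀ k j, k < j → ‖γ k j‖ < 1) (n : ℕ) :
    IsUnit (arrayPhiSharp K γ n) := by
  refine isUnit_of_entry_diag_ne_zero fun k => ?_
  rw [arrayPhiSharp, entry_mkArray, if_pos le_rfl, Nat.sub_self]
  exact coeff_zero_orthPolySharp_ne_zero hK hγ n k

theorem isOrthogonalFamily_orthPoly {H : Type*} [NormedAddCommGroup H] [InnerProductSpace ℂ H]
    {v : ℕ → H} {K : Matrix ℕ ℕ ℂ} (hv : LinearIndependent ℂ v)
    (hK : ∀ k j, inner ℂ (v k) (v j) = K k j) (hK' : ∀ k, 0 < (K k k).re) (l : ℕ) :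
    IsOrthogonalFamily (shiftKernel K l) fun n => orthPoly K (reflectionFamily v) n l := by
  have hpos := coeff_orthPoly_pos hK' (isParameterFamily_reflectionFamily hv hK).norm_lt_one
  have hdeg : ∀ n, (orthPoly K (reflectionFamily v) n l).natDegree = n := fun n =>
    natDegree_eq_of_le_of_coeff_ne_zero (natDegree_polyPair_le _ _ n l).1 (hpos n l).ne'
  refine ⟨hdeg, fun n => ?_, fun n m => ?_⟩
  · rw [leadingCoeff, hdeg]
    exact hpos n l
  · rw [← inner_polyVec hK, (polyVec_polyPair hK n l).1, (polyVec_polyPair hK m l).1,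
      orthonormal_iff_ite.1 (forward_orthonormal hv l)]
    exact if_congr eq_comm rfl rfl

/-- The product of an array with rows `⟨e_i, v_k⟩` and an array with columns of polynomial
coefficients. -/
lemma entry_mul_mkArray_coeff {H : Type*} [NormedAddCommGroup H] [InnerProductSpace ℂ H]
    {v e : ℕ → H} {Θ : LowerArray} (hΘ : ∀ k j, entry Θ k j = inner ℂ (e k) (v j))
    (p : ℕ → ℂ[X]) {i j : ℕ} (hij : j ≤ i) :
    entry (Θ * mkArray fun k j => (p j).coeff (k - j)) i j = inner ℂ (e i) (polyVec v j (p j)) := by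
  -- The range covers both the degree and the rows up to i; terms beyond row i vanish because Θ is
  -- lower triangular.
  rw [entry_mul, polyVec_apply, sum_over_range' _ (by simp) (max ((p j).natDegree + 1) (i + 1 - j))
    (by simp), inner_sum]
  have h1 : ∀ l ∈ Finset.Icc j i, entry Θ i l * entry (mkArray fun k j => (p j).coeff (k - j)) l j =
      (p j).coeff (l - j) * entry Θ i l := fun l hl => by
    rw [entry_mkArray, if_pos (Finset.mem_Icc.1 hl).1, mul_comm]
  rw [Finset.sum_congr rfl h1, ← Finset.Ico_add_one_right_eq_Icc, Finset.sum_Ico_eq_sum_range]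
  simp only [inner_smul_right, ← hΘ, add_tsub_cancel_left]
  simp only [add_comm j]
  refine Finset.sum_subset (Finset.range_subset_range.2 (le_max_right _ _)) fun m _ hm => ?_
  rw [entry_of_lt Θ, mul_zero]
  simp only [Finset.mem_range, not_lt] at hm
  omega

/-! ### Innovations of a sequence of vectors -/

section Innovations

variable {H : Type*} [NormedAddCommGroup H] [InnerProductSpace ℂ H]

/-- The closed span of `v k, v (k + 1), …`. -/
abbrev tailSpan (v : ℕ → H) (k : ℕ) : Submodule ℂ H :=
  (Submodule.span ℂ (v '' Set.Ici k)).topologicalClosure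

/-- The span of `v (k + 1), …, v (k + n)`. -/
abbrev windowSpan (v : ℕ → H) (k n : ℕ) : Submodule ℂ H :=
  Submodule.span ℂ (v '' Set.Ioc k (k + n))

instance (v : ℕ → H) (k n : ℕ) : FiniteDimensional ℂ (windowSpan v k n) :=
  FiniteDimensional.span_of_finite ℂ ((Set.finite_Ioc _ _).image v)

lemma tailSpan_antitone (v : ℕ → H) : Antitone (tailSpan v) := fun _ _ h =>
  Submodule.topologicalClosure_mono (span_image_mono (Set.Ici_subset_Ici.2 h))

lemma mem_tailSpan (v : ℕ → H) {k j : ℕ} (h : k ≤ j) : v j ∈ tailSpan v k :=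
  Submodule.le_topologicalClosure _ (mem_span_image h)

lemma windowSpan_mono (v : ℕ → H) (k : ℕ) : Monotone (windowSpan v k) := fun _ _ h =>
  span_image_mono (Set.Ioc_subset_Ioc_right (by omega))

lemma iSup_windowSpan (v : ℕ → H) (k : ℕ) :
    ⨆ n, windowSpan v k n = Submodule.span ℂ (v '' Set.Ici (k + 1)) := by
  rw [← Submodule.span_iUnion, ← Set.image_iUnion]
  congr 2
  ext i
  simp only [Set.mem_iUnion, Set.mem_Ioc, Set.mem_Ici]
  exact ⟨fun ⟨n, h, _⟩ => h, fun h => ⟨i, h, by omega⟩⟩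

variable [CompleteSpace H]

/-- The component of `v k` orthogonal to all later vectors. -/
def innovation (v : ℕ → H) (k : ℕ) : H := v k - (tailSpan v (k + 1)).starProjection (v k)

/-- The normalized innovation; it is `0` if the innovation vanishes. -/
def unitInnovation (v : ℕ → H) (k : ℕ) : H := (‖innovation v k‖⁻¹ : ℂ) • innovation v k

lemma tendsto_window_residual (v : ℕ → H) (k : ℕ) :
    Tendsto (fun n => v k - (windowSpan v k n).starProjection (v k)) atTop
      (𝓝 (innovation v k)) := by
  have := Submodule.starProjection_tendsto_closure_iSup _ (windowSpan_mono v k) (v k)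
  simp only [iSup_windowSpan] at this
  exact tendsto_const_nhds.sub this

lemma innovation_mem_tailSpan (v : ℕ → H) (k : ℕ) : innovation v k ∈ tailSpan v k :=
  Submodule.sub_mem _ (mem_tailSpan v le_rfl)
    (tailSpan_antitone v k.le_succ (Submodule.starProjection_apply_mem _ _))

lemma unitInnovation_mem_tailSpan (v : ℕ → H) (k : ℕ) : unitInnovation v k ∈ tailSpan v k :=
  Submodule.smul_mem _ _ (innovation_mem_tailSpan v k)

lemma inner_innovation_of_mem (v : ℕ → H) {k : ℕ} {x : H} (hx : x ∈ tailSpan v (k + 1)) :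
    inner ℂ (innovation v k) x = 0 :=
  Submodule.starProjection_inner_eq_zero _ _ hx

lemma inner_unitInnovation_of_mem (v : ℕ → H) {k : ℕ} {x : H} (hx : x ∈ tailSpan v (k + 1)) :
    inner ℂ (unitInnovation v k) x = 0 := by
  rw [unitInnovation, inner_smul_left, inner_innovation_of_mem v hx, mul_zero]

lemma inner_unitInnovation_of_lt (v : ℕ → H) {k j : ℕ} (h : k < j) :
    inner ℂ (unitInnovation v k) (v j) = 0 :=
  inner_unitInnovation_of_mem v (mem_tailSpan v h)

lemma inner_innovation_self (v : ℕ → H) (k : ℕ) :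
    inner ℂ (innovation v k) (v k) = ((‖innovation v k‖ ^ 2 : ℝ) : ℂ) := by
  have : v k = innovation v k + (tailSpan v (k + 1)).starProjection (v k) :=
    (sub_add_cancel _ _).symm
  rw [this, inner_add_right, inner_innovation_of_mem v (Submodule.starProjection_apply_mem _ _),
    add_zero, inner_self_eq_norm_sq_to_K]
  norm_cast

lemma inner_unitInnovation_self (v : ℕ → H) (k : ℕ) :
    inner ℂ (unitInnovation v k) (v k) = (‖innovation v k‖ : ℂ) := by
  rw [unitInnovation, inner_smul_left, inner_innovation_self]
  simp only [map_inv₀, Complex.conj_ofReal, Complex.ofReal_pow]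
  by_cases h : (‖innovation v k‖ : ℂ) = 0
  · simp [h]
  · field_simp

lemma norm_unitInnovation {v : ℕ → H} {k : ℕ} (h : innovation v k ≠ 0) :
    ‖unitInnovation v k‖ = 1 := by
  rw [unitInnovation, norm_smul, norm_inv, Complex.norm_real, norm_norm,
    inv_mul_cancel₀ (norm_ne_zero_iff.2 h)]

lemma inner_unitInnovation_unitInnovation (v : ℕ → H) {i j : ℕ} (h : i ≠ j) :
    inner ℂ (unitInnovation v i) (unitInnovation v j) = 0 := by
  have key : ∀ i j, i < j → inner ℂ (unitInnovation v i) (unitInnovation v j) = 0 :=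
    fun i j hij => inner_unitInnovation_of_mem v
      (tailSpan_antitone v hij (unitInnovation_mem_tailSpan v j))
  rcases lt_or_gt_of_ne h with h | h
  · exact key i j h
  · exact inner_eq_zero_symm.1 (key j i h)

/-- A vector of `tailSpan v k` orthogonal to the innovation belongs to `tailSpan v (k + 1)`. -/
lemma mem_tailSpan_succ {v : ℕ → H} {k : ℕ} {x : H} (hx : x ∈ tailSpan v k)
    (h : inner ℂ (unitInnovation v k) x = 0) : x ∈ tailSpan v (k + 1) := by
  have hinn : inner ℂ (innovation v k) x = 0 := by
    rw [unitInnovation, inner_smul_left, mul_eq_zero] at h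
    rcases h with h | h
    · have : innovation v k = 0 := by simpa using h
      rw [this, inner_zero_left]
    · exact h
  -- Q kills the later vectors and sends v_k to its innovation, so it maps the tail from k into the
  -- line of the innovation. There Q x is also orthogonal to the innovation, hence zero.
  set Q : H →L[ℂ] H := 1 - (tailSpan v (k + 1)).starProjection with hQ
  have hQapp : ∀ y, Q y = y - (tailSpan v (k + 1)).starProjection y := fun y => rfl
  have hmap : Submodule.span ℂ (v '' Set.Ici k) ≤ (ℂ ∙ innovation v k).comap Q.toLinearMap := by
    rw [Submodule.span_le]
    rintro _ ⟨j, hj, rfl⟩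
    change Q (v j) ∈ ℂ ∙ innovation v k
    rcases (Set.mem_Ici.1 hj).eq_or_lt with rfl | hj
    · exact Submodule.mem_span_singleton_self _
    · rw [hQapp, Submodule.starProjection_eq_self_iff.2 (mem_tailSpan v hj), sub_self]
      exact Submodule.zero_mem _
  have hclosed : IsClosed (((ℂ ∙ innovation v k).comap Q.toLinearMap : Submodule ℂ H) : Set H) :=
    (Submodule.closed_of_finiteDimensional (ℂ ∙ innovation v k)).preimage Q.continuous
  have hxQ : Q x ∈ ℂ ∙ innovation v k :=
    Submodule.topologicalClosure_minimal _ hmap hclosed hx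
  obtain ⟨a, ha⟩ := Submodule.mem_span_singleton.1 hxQ
  have h0 : inner ℂ (Q x) (Q x) = 0 := by
    nth_rw 1 [← ha]
    rw [inner_smul_left, hQapp, inner_sub_right, hinn,
      inner_innovation_of_mem v (Submodule.starProjection_apply_mem _ _), sub_zero, mul_zero]
  rw [inner_self_eq_zero, hQapp, sub_eq_zero] at h0
  exact Submodule.starProjection_eq_self_iff.1 h0.symm

lemma inner_linearCombination_congr {E E' : Type*} [NormedAddCommGroup E] [InnerProductSpace ℂ E]
    [NormedAddCommGroup E'] [InnerProductSpace ℂ E'] {c : ℕ → E} {c' : ℕ → E'}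
    (h : ∀ k j, inner ℂ (c k) (c j) = inner ℂ (c' k) (c' j)) (x y : ℕ →₀ ℂ) :
    inner ℂ (Finsupp.linearCombination ℂ c x) (Finsupp.linearCombination ℂ c y) =
      inner ℂ (Finsupp.linearCombination ℂ c' x) (Finsupp.linearCombination ℂ c' y) := by
  simp only [inner_linearCombination, h]

/-- The inner products with the innovations are determined by the Gram matrix. -/
theorem inner_innovation_congr {E E' : Type*} [NormedAddCommGroup E] [InnerProductSpace ℂ E]
    [CompleteSpace E] [NormedAddCommGroup E'] [InnerProductSpace ℂ E'] [CompleteSpace E']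
    {c : ℕ → E} {c' : ℕ → E'} (h : ∀ k j, inner ℂ (c k) (c j) = inner ℂ (c' k) (c' j)) (k j : ℕ) :
    inner ℂ (innovation c k) (c j) = inner ℂ (innovation c' k) (c' j) := by
  -- The normal equations of a window projection involve only the Gram matrix, so the same
  -- coefficients x give the projection for both sequences; then n → ∞.
  have hfin : ∀ n, inner ℂ (c k - (windowSpan c k n).starProjection (c k)) (c j) =
      inner ℂ (c' k - (windowSpan c' k n).starProjection (c' k)) (c' j) := by
    intro n
    obtain ⟨x, hx, hxc⟩ := (Finsupp.mem_span_image_iff_linearCombination ℂ).1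
      ((windowSpan c k n).starProjection_apply_mem (c k))
    have hsingle : ∀ i, inner ℂ (c k - Finsupp.linearCombination ℂ c x) (c i) =
        inner ℂ (c' k - Finsupp.linearCombination ℂ c' x) (c' i) := fun i => by
      have := inner_linearCombination_congr h (Finsupp.single k 1 - x) (Finsupp.single i 1)
      simpa using this
    have hproj : (windowSpan c' k n).starProjection (c' k) = Finsupp.linearCombination ℂ c' x := by
      refine Submodule.eq_starProjection_of_mem_of_inner_eq_zero
        ((Finsupp.mem_span_image_iff_linearCombination ℂ).2 ⟨x, hx, rfl⟩) fun w hw => ?_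
      rw [inner_eq_zero_symm]
      refine inner_eq_zero_of_mem_span (fun i hi => ?_) hw
      rw [inner_eq_zero_symm, ← hsingle, hxc]
      exact Submodule.starProjection_inner_eq_zero _ _ (mem_span_image hi)
    rw [hproj, ← hxc]
    exact hsingle j
  refine tendsto_nhds_unique ((tendsto_window_residual c k).inner tendsto_const_nhds) ?_
  simp only [hfin]
  exact (tendsto_window_residual c' k).inner tendsto_const_nhds

end Innovations

/-! ### Uniqueness of the spectral factor -/

instance (F : ℕ → Submodule ℂ ℂ) (n : ℕ) : CompleteSpace (F n) :=
  FiniteDimensional.complete ℂ (F n)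

section Outer

variable {F : ℕ → Type*} [∀ n, NormedAddCommGroup (F n)] [∀ n, InnerProductSpace ℂ (F n)]
  {c : ℕ → lp F 2}

lemma IsOuter.coe_tailSpan (h : IsOuter c) (k : ℕ) :
    (tailSpan c k : Set (lp F 2)) = {x | ∀ i, i < k → x i = 0} := by
  rw [← h k, tailSpan, Submodule.topologicalClosure_coe]
  congr 3
  ext x
  simp [eq_comm]

/-- Outerness identifies the tail from k + 1 with the sequences vanishing up to k, and triangularity
leaves only the diagonal coordinate of c_k outside it. -/
lemma IsOuter.innovation_eq [∀ n, CompleteSpace (F n)] (h : IsOuter c)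
    (hl : IsLowerTriangular c) (k : ℕ) : innovation c k = lp.single 2 k (c k k) := by
  have hmem : ∀ x : lp F 2, x ∈ tailSpan c (k + 1) ↔ ∀ i, i < k + 1 → x i = 0 := fun x => by
    rw [← SetLike.mem_coe, h.coe_tailSpan]
    rfl
  have hproj : (tailSpan c (k + 1)).starProjection (c k) = c k - lp.single 2 k (c k k) := by
    refine Submodule.eq_starProjection_of_mem_of_inner_eq_zero ((hmem _).2 fun i hi => ?_)
      fun w hw => ?_
    · rw [lp.coeFn_sub, Pi.sub_apply]
      rcases (Nat.lt_succ_iff.1 hi).eq_or_lt with rfl | hi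
      · rw [lp.single_apply_self, sub_self]
      · rw [hl k i hi, lp.single_apply_ne _ _ _ hi.ne, sub_zero]
    · rw [sub_sub_cancel, lp.inner_single_left, (hmem w).1 hw k k.lt_succ_self, inner_zero_right]
  rw [innovation, hproj, sub_sub_cancel]

/-- If a diagonal entry of an outer array vanishes, then the space `F k` is trivial. -/
lemma IsOuter.eq_zero_of_diag_eq_zero (h : IsOuter c) (hl : IsLowerTriangular c) {k : ℕ}
    (hk : c k k = 0) (a : F k) : a = 0 := by
  have hsub : closure (Submodule.span ℂ {x | ∃ j, k ≤ j ∧ x = c j} : Set (lp F 2)) ⊆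
      {x | inner ℂ (lp.single 2 k a) x = 0} := by
    refine closure_minimal ?_ (isClosed_eq (by fun_prop) continuous_const)
    have : Submodule.span ℂ {x | ∃ j, k ≤ j ∧ x = c j} ≤ (ℂ ∙ (lp.single 2 k a : lp F 2))ᗮ := by
      rw [Submodule.span_le]
      rintro _ ⟨j, hj, rfl⟩
      refine (Submodule.mem_orthogonal_singleton_iff_inner_right).2 ?_
      rw [lp.inner_single_left]
      rcases hj.eq_or_lt with rfl | hj
      · rw [hk, inner_zero_right]
      · rw [hl j k hj, inner_zero_right]
    exact fun x hx => (Submodule.mem_orthogonal_singleton_iff_inner_right).1 (this hx)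
  have hmem : (lp.single 2 k a : lp F 2) ∈
      closure (Submodule.span ℂ {x | ∃ j, k ≤ j ∧ x = c j} : Set (lp F 2)) := by
    rw [h k]
    intro i hi
    exact lp.single_apply_ne _ _ _ hi.ne
  have := hsub hmem
  simpa [lp.inner_single_left] using this

end Outer

/-- A kernel has at most one normalized spectral factor. -/
theorem IsSpectralFactor.unique {K : Matrix ℕ ℕ ℂ} {Θ Θ' : LowerArray} (h : IsSpectralFactor K Θ)
    (h' : IsSpectralFactor K Θ') : Θ = Θ' := by
  obtain ⟨F, c, hc, hΘ, hpos⟩ := h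
  obtain ⟨F', c', hc', hΘ', hpos'⟩ := h'
  -- Each factor competes in the maximality of the other.
  have hker : columnKernel c = columnKernel c' :=
    (hc'.maximal _ c hc.lower hc.outer hc.le).antisymm
      (hc.maximal _ c' hc'.lower hc'.outer hc'.le)
  have hgram : ∀ k j, inner ℂ (c k) (c j) = inner ℂ (c' k) (c' j) := fun k j =>
    congrFun (congrFun hker k) j
  have key : ∀ k j, conj (entry Θ k k) * entry Θ k j = conj (entry Θ' k k) * entry Θ' k j := by
    intro k j
    have := inner_innovation_congr hgram k j
    rw [hc.outer.innovation_eq hc.lower, hc'.outer.innovation_eq hc'.lower, lp.inner_single_left,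
      lp.inner_single_left, Submodule.coe_inner, Submodule.coe_inner, RCLike.inner_apply,
      RCLike.inner_apply] at this
    rw [hΘ, hΘ, hΘ', hΘ', mul_comm, this, mul_comm]
  have hdiag : ∀ k, entry Θ k k = entry Θ' k k := by
    intro k
    have hk := key k k
    obtain ⟨hr, hi⟩ := Complex.nonneg_iff.1 (hpos k)
    obtain ⟨hr', hi'⟩ := Complex.nonneg_iff.1 (hpos' k)
    have hre := congrArg Complex.re hk
    simp only [Complex.mul_re, Complex.conj_re, Complex.conj_im, ← hi, ← hi', mul_zero, sub_zero,
      ← sq] at hre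
    exact Complex.ext ((sq_eq_sq₀ hr hr').1 hre) (hi.symm.trans hi')
  refine LowerArray.ext_entry fun k j => ?_
  -- A zero diagonal entry gives no equation for its row, but outerness then makes the space F_k
  -- trivial.
  by_cases h0 : entry Θ k k = 0
  · have h1 : c k k = 0 := by rw [← Submodule.coe_eq_zero, ← hΘ, h0]
    have h2 : c' k k = 0 := by rw [← Submodule.coe_eq_zero, ← hΘ', ← hdiag, h0]
    rw [hΘ, hΘ', hc.outer.eq_zero_of_diag_eq_zero hc.lower h1 (c j k),
      hc'.outer.eq_zero_of_diag_eq_zero hc'.lower h2 (c' j k)]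
    rfl
  · have := key k j
    rw [← hdiag] at this
    exact mul_left_cancel₀ (by simpa using h0) this

/-! ### Existence of the spectral factor -/

section Existence

variable {H : Type*} [NormedAddCommGroup H] [InnerProductSpace ℂ H] [CompleteSpace H]

open Classical in
/-- The coefficient space of the `k`-th innovation. -/
def innovationSpace (v : ℕ → H) (k : ℕ) : Submodule ℂ ℂ := if innovation v k = 0 then ⊥ else ⊤

lemma eq_zero_of_mem_innovationSpace {v : ℕ → H} {k : ℕ} (h : innovation v k = 0)
    (z : innovationSpace v k) : (z : ℂ) = 0 := by
  have hbot : innovationSpace v k = ⊥ := if_pos h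
  exact (Submodule.mem_bot ℂ).1 (hbot.le z.2)

/-- The embedding `z ↦ z • e_k` of the coefficient space. -/
def innovationEmbedding (v : ℕ → H) (k : ℕ) : innovationSpace v k →ₗᵢ[ℂ] H where
  toLinearMap := (LinearMap.toSpanSingleton ℂ H (unitInnovation v k)).comp
    (innovationSpace v k).subtype
  norm_map' z := by
    change ‖(z : ℂ) • unitInnovation v k‖ = ‖(z : ℂ)‖
    by_cases h : innovation v k = 0
    · rw [eq_zero_of_mem_innovationSpace h z, zero_smul, norm_zero, norm_zero]
    · rw [norm_smul, norm_unitInnovation h, mul_one]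

lemma innovationEmbedding_apply (v : ℕ → H) (k : ℕ) (z : innovationSpace v k) :
    innovationEmbedding v k z = (z : ℂ) • unitInnovation v k := rfl

lemma orthogonalFamily_innovationEmbedding (v : ℕ → H) :
    OrthogonalFamily ℂ (fun k => innovationSpace v k) (innovationEmbedding v) := by
  intro i j hij x y
  rw [innovationEmbedding_apply, innovationEmbedding_apply, inner_smul_left, inner_smul_right,
    inner_unitInnovation_unitInnovation v hij, mul_zero, mul_zero]

/-- The synthesis map `x ↦ ∑ x_k e_k`. -/
def synthesis (v : ℕ → H) : lp (fun k => innovationSpace v k) 2 →ₗᵢ[ℂ] H :=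
  (orthogonalFamily_innovationEmbedding v).linearIsometry

/-- The analysis map `y ↦ (⟨e_k, y⟩)_k`. -/
def analysis (v : ℕ → H) : H →L[ℂ] lp (fun k => innovationSpace v k) 2 :=
  ContinuousLinearMap.adjoint (synthesis v).toContinuousLinearMap

lemma inner_analysis (v : ℕ → H) (x : lp (fun k => innovationSpace v k) 2) (y : H) :
    inner ℂ x (analysis v y) = inner ℂ (synthesis v x) y :=
  ContinuousLinearMap.adjoint_inner_right _ _ _

lemma analysis_synthesis (v : ℕ → H) (x : lp (fun k => innovationSpace v k) 2) :
    analysis v (synthesis v x) = x :=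
  ext_inner_left ℂ fun y => by rw [inner_analysis, LinearIsometry.inner_map_map]

lemma coe_analysis_apply (v : ℕ → H) (y : H) (k : ℕ) :
    ((analysis v y k : innovationSpace v k) : ℂ) = inner ℂ (unitInnovation v k) y := by
  by_cases h : innovation v k = 0
  · rw [eq_zero_of_mem_innovationSpace h, unitInnovation, h, smul_zero, inner_zero_left]
  · have h1 : (1 : ℂ) ∈ innovationSpace v k := by
      rw [innovationSpace, if_neg h]
      trivial
    have := inner_analysis v (lp.single 2 k ⟨1, h1⟩) y
    rw [lp.inner_single_left, synthesis, OrthogonalFamily.linearIsometry_apply_single,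
      innovationEmbedding_apply, Submodule.coe_inner, RCLike.inner_apply] at this
    simpa using this

lemma synthesis_mem_tailSpan (v : ℕ → H) {k : ℕ} {x : lp (fun k => innovationSpace v k) 2}
    (hx : ∀ i, i < k → x i = 0) : synthesis v x ∈ tailSpan v k := by
  have hsum := (orthogonalFamily_innovationEmbedding v).hasSum_linearIsometry x
  refine (Submodule.isClosed_topologicalClosure _).mem_of_tendsto hsum
    (Eventually.of_forall fun s => Submodule.sum_mem _ fun i _ => ?_)
  rw [innovationEmbedding_apply]
  rcases lt_or_ge i k with hi | hi
  · rw [hx i hi, ZeroMemClass.coe_zero, zero_smul]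
    exact Submodule.zero_mem _
  · exact Submodule.smul_mem _ _ (tailSpan_antitone v hi (unitInnovation_mem_tailSpan v i))

/-- The remainder after removing all innovations lies in every tail. -/
lemma sub_synthesis_analysis_mem_tailSpan (v : ℕ → H) {y : H} (hy : y ∈ tailSpan v 0) (k : ℕ) :
    y - synthesis v (analysis v y) ∈ tailSpan v k := by
  induction k with
  | zero => exact Submodule.sub_mem _ hy (synthesis_mem_tailSpan v (by simp))
  | succ k ih =>
    refine mem_tailSpan_succ ih ?_
    rw [← coe_analysis_apply, map_sub, analysis_synthesis, sub_self]
    rfl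

lemma norm_analysis_eq (v : ℕ → H) (y : H) :
    ‖analysis v y‖ = ‖synthesis v (analysis v y)‖ :=
  ((synthesis v).norm_map _).symm

lemma norm_analysis_le (v : ℕ → H) (y : H) : ‖analysis v y‖ ≤ ‖y‖ := by
  have h : inner ℂ (analysis v y) (analysis v y) = inner ℂ (synthesis v (analysis v y)) y :=
    inner_analysis v _ y
  have h1 : ‖analysis v y‖ * ‖analysis v y‖ ≤ ‖analysis v y‖ * ‖y‖ := by
    rw [← inner_self_eq_norm_mul_norm (𝕜 := ℂ), h]
    refine (RCLike.re_le_norm _).trans ((norm_inner_le_norm _ _).trans ?_)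
    rw [← norm_analysis_eq]
  rcases (norm_nonneg (analysis v y)).eq_or_lt with h0 | h0
  · rw [← h0]
    exact norm_nonneg _
  · exact le_of_mul_le_mul_left h1 h0

/-- The columns `(⟨e_k, v_j⟩)_k`. -/
def factorColumn (v : ℕ → H) (j : ℕ) : lp (fun k => innovationSpace v k) 2 := analysis v (v j)

lemma linearCombination_factorColumn (v : ℕ → H) (x : ℕ →₀ ℂ) :
    Finsupp.linearCombination ℂ (factorColumn v) x =
      analysis v (Finsupp.linearCombination ℂ v x) :=
  (Finsupp.apply_linearCombination ℂ (analysis v).toLinearMap v x).symm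

lemma isLowerTriangular_factorColumn (v : ℕ → H) : IsLowerTriangular (factorColumn v) :=
  fun j k h => by
    rw [← Submodule.coe_eq_zero, factorColumn, coe_analysis_apply, inner_unitInnovation_of_lt v h]

/-- Vectors of the tail from k are orthogonal to e_i for i < k, which gives one inclusion. For the
other, a sequence supported from k on is the analysis of its own synthesis, which lies in that tail,
and analysis sends the tail into the closed span of the columns. -/
lemma isOuter_factorColumn (v : ℕ → H) : IsOuter (factorColumn v) := by
  intro k
  have hset : {x | ∃ j, k ≤ j ∧ x = factorColumn v j} = factorColumn v '' Set.Ici k := by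
    ext x
    simp [eq_comm]
  rw [hset, ← Submodule.topologicalClosure_coe]
  refine Set.Subset.antisymm (fun x hx i hi => ?_) fun x hx => ?_
  · have hle : Submodule.span ℂ (factorColumn v '' Set.Ici k) ≤
        (tailSpan v k).map (analysis v).toLinearMap := by
      rw [Submodule.span_le]
      rintro _ ⟨j, hj, rfl⟩
      exact ⟨v j, mem_tailSpan v hj, rfl⟩
    have hcont : Continuous fun x : lp (fun k => innovationSpace v k) 2 =>
        (inner ℂ (unitInnovation v i) (synthesis v x) : ℂ) := by fun_prop
    have hzero : inner ℂ (unitInnovation v i) (synthesis v x) = 0 := by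
      rw [Submodule.topologicalClosure_coe] at hx
      refine closure_minimal (s := (Submodule.span ℂ (factorColumn v '' Set.Ici k) : Set _))
        (t := {x | inner ℂ (unitInnovation v i) (synthesis v x) = 0}) ?_
        (isClosed_eq hcont continuous_const) hx
      intro z hz
      obtain ⟨y, hy, rfl⟩ := hle hz
      change inner ℂ (unitInnovation v i) (synthesis v (analysis v y)) = 0
      rw [← coe_analysis_apply, analysis_synthesis, coe_analysis_apply]
      exact inner_unitInnovation_of_mem v (tailSpan_antitone v hi hy)
    rwa [← coe_analysis_apply, analysis_synthesis, Submodule.coe_eq_zero] at hzero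
  · have hle : Submodule.span ℂ (v '' Set.Ici k) ≤
        ((Submodule.span ℂ (factorColumn v '' Set.Ici k)).topologicalClosure).comap
          (analysis v).toLinearMap := by
      rw [Submodule.span_le]
      rintro _ ⟨j, hj, rfl⟩
      exact Submodule.le_topologicalClosure _ (mem_span_image hj)
    have := Submodule.topologicalClosure_minimal _ hle
      ((Submodule.isClosed_topologicalClosure _).preimage (analysis v).continuous)
      (synthesis_mem_tailSpan v hx)
    rwa [Submodule.mem_comap, ContinuousLinearMap.coe_coe, analysis_synthesis] at this

/-- With its converse `norm_linearCombination_le_of_posSemidef`, this translates the order of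
kernels into contractivity of the map c_k ↦ c'_k. -/
lemma posSemidef_of_gram_sub {E E' : Type*} [SeminormedAddCommGroup E] [InnerProductSpace ℂ E]
    [SeminormedAddCommGroup E'] [InnerProductSpace ℂ E'] {c : ℕ → E} {c' : ℕ → E'}
    {K : Matrix ℕ ℕ ℂ} (hK : ∀ k j, K k j = inner ℂ (c k) (c j) - inner ℂ (c' k) (c' j))
    (h : ∀ x, ‖Finsupp.linearCombination ℂ c' x‖ ≤ ‖Finsupp.linearCombination ℂ c x‖) :
    K.PosSemidef := by
  refine ⟨?_, fun x => ?_⟩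
  · ext k j
    rw [Matrix.conjTranspose_apply, hK, hK, star_sub, ← inner_conj_symm (c k),
      ← inner_conj_symm (c' k)]
    rfl
  · simp only [hK, mul_sub, sub_mul]
    simp only [Finsupp.sum_sub]
    rw [quadraticForm_gram, quadraticForm_gram, ← Complex.ofReal_sub, Complex.zero_le_real,
      sub_nonneg]
    exact pow_le_pow_left₀ (norm_nonneg _) (h x) 2

lemma norm_linearCombination_le_of_posSemidef {E E' : Type*} [SeminormedAddCommGroup E]
    [InnerProductSpace ℂ E] [SeminormedAddCommGroup E'] [InnerProductSpace ℂ E'] {c : ℕ → E}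
    {c' : ℕ → E'} {K : Matrix ℕ ℕ ℂ}
    (hK : ∀ k j, K k j = inner ℂ (c k) (c j) - inner ℂ (c' k) (c' j)) (h : K.PosSemidef)
    (x : ℕ →₀ ℂ) :
    ‖Finsupp.linearCombination ℂ c' x‖ ≤ ‖Finsupp.linearCombination ℂ c x‖ := by
  have := h.2 x
  simp only [hK, mul_sub, sub_mul] at this
  simp only [Finsupp.sum_sub] at this
  rw [quadraticForm_gram, quadraticForm_gram, ← Complex.ofReal_sub, Complex.zero_le_real,
    sub_nonneg] at this
  exact le_of_sq_le_sq this (norm_nonneg _)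

/-- Subtracting t leaves the first n coordinates of w unchanged, so every finite partial sum of the
norm is bounded. This discards the contribution of vectors lying in all tails. -/
lemma norm_le_of_forall_truncation {F : ℕ → Type*} [∀ n, NormedAddCommGroup (F n)]
    [∀ n, InnerProductSpace ℂ (F n)] {w : lp F 2} {C : ℝ} (hC : 0 ≤ C)
    (h : ∀ n, ∃ t : lp F 2, (∀ i, i < n → t i = 0) ∧ ‖w - t‖ ≤ C) : ‖w‖ ≤ C := by
  refine lp.norm_le_of_forall_sum_le (by simp) hC fun s => ?_
  obtain ⟨n, hn⟩ := s.exists_nat_subset_range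
  obtain ⟨t, ht, htC⟩ := h n
  have hs : ∑ i ∈ s, ‖w i‖ ^ (2 : ENNReal).toReal =
      ∑ i ∈ s, ‖(w - t) i‖ ^ (2 : ENNReal).toReal := by
    refine Finset.sum_congr rfl fun i hi => ?_
    rw [lp.coeFn_sub, Pi.sub_apply, ht i (Finset.mem_range.1 (hn hi)), sub_zero]
  rw [hs]
  exact (lp.sum_rpow_le_norm_rpow (by simp) _ s).trans
    (Real.rpow_le_rpow (norm_nonneg _) htC (by simp))

/-- The columns of inner products with the innovations form a maximal outer array. -/
theorem isMaximalOuter_factorColumn {v : ℕ → H} {K : Matrix ℕ ℕ ℂ}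
    (hK : ∀ k j, inner ℂ (v k) (v j) = K k j) : IsMaximalOuter K (factorColumn v) := by
  refine ⟨isLowerTriangular_factorColumn v, isOuter_factorColumn v,
    posSemidef_of_gram_sub (c := v) (c' := factorColumn v)
      (fun k j => by rw [Matrix.sub_apply, hK]; rfl) fun x => ?_, ?_⟩
  · rw [linearCombination_factorColumn]
    exact norm_analysis_le v _
  intro F' _ _ _ c' hl _ hle
  refine posSemidef_of_gram_sub (c := factorColumn v) (c' := c') (fun k j => rfl) fun x => ?_
  have hcontr := norm_linearCombination_le_of_posSemidef (c := v) (c' := c')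
    (fun k j => by rw [Matrix.sub_apply, hK]; rfl) hle
  rw [linearCombination_factorColumn]
  set y := Finsupp.linearCombination ℂ v x with hy
  have hy0 : y ∈ tailSpan v 0 := by
    refine Submodule.le_topologicalClosure _ ?_
    exact (Finsupp.mem_span_image_iff_linearCombination ℂ).2
      ⟨x, Finsupp.mem_supported _ _ |>.2 fun i _ => Nat.zero_le i, rfl⟩
  -- For each n the part of y outside the innovations is within ε of a combination u of v_n,
  -- v_{n+1}, …. The matching combination of c' has no coordinates below n, and removing it costs
  -- nothing by the truncation bound.
  refine le_of_forall_pos_le_add fun ε hε => norm_le_of_forall_truncation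
    (add_nonneg (norm_nonneg _) hε.le) fun n => ?_
  have hz := sub_synthesis_analysis_mem_tailSpan v hy0 n
  rw [← SetLike.mem_coe, Submodule.topologicalClosure_coe, Metric.mem_closure_iff] at hz
  obtain ⟨z, hz, hdist⟩ := hz ε hε
  obtain ⟨u, hu, rfl⟩ := (Finsupp.mem_span_image_iff_linearCombination ℂ).1 hz
  refine ⟨Finsupp.linearCombination ℂ c' u, fun i hi => ?_, ?_⟩
  · have hle : Submodule.span ℂ (c' '' Set.Ici n) ≤
        LinearMap.ker (lp.evalₗ F' 2 i : lp F' 2 →ₗ[ℂ] F' i) := by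
      rw [Submodule.span_le]
      rintro _ ⟨j, hj, rfl⟩
      exact hl j i (lt_of_lt_of_le hi hj)
    exact hle ((Finsupp.mem_span_image_iff_linearCombination ℂ).2 ⟨u, hu, rfl⟩)
  · rw [← map_sub]
    refine (hcontr _).trans ?_
    rw [map_sub, ← hy, norm_analysis_eq]
    calc ‖y - Finsupp.linearCombination ℂ v u‖
        = ‖synthesis v (analysis v y) + (y - synthesis v (analysis v y) -
            Finsupp.linearCombination ℂ v u)‖ := by congr 1; abel
      _ ≤ _ := (norm_add_le _ _).trans (by rw [← dist_eq_norm (y - _)]; gcongr)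

/-- The array `⟨e_k, v_j⟩`. -/
def factorArray (v : ℕ → H) : LowerArray := mkArray fun k j => inner ℂ (unitInnovation v k) (v j)

lemma entry_factorArray (v : ℕ → H) (k j : ℕ) :
    entry (factorArray v) k j = inner ℂ (unitInnovation v k) (v j) := by
  rw [factorArray, entry_mkArray]
  split_ifs with h
  · rfl
  · rw [inner_unitInnovation_of_lt v (not_le.1 h)]

lemma entry_factorArray_self (v : ℕ → H) (k : ℕ) :
    entry (factorArray v) k k = (‖innovation v k‖ : ℂ) := by
  rw [entry_factorArray, inner_unitInnovation_self]

theorem isSpectralFactor_factorArray {v : ℕ → H} {K : Matrix ℕ ℕ ℂ}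
    (hK : ∀ k j, inner ℂ (v k) (v j) = K k j) : IsSpectralFactor K (factorArray v) := by
  refine ⟨innovationSpace v, factorColumn v, isMaximalOuter_factorColumn hK, fun k j => ?_,
    fun n => ?_⟩
  · rw [entry_factorArray, factorColumn, coe_analysis_apply]
  · rw [entry_factorArray_self]
    exact_mod_cast norm_nonneg _

theorem isSzegoClass_iff_innovation_ne_zero {v : ℕ → H} {K : Matrix ℕ ℕ ℂ}
    (hK : ∀ k j, inner ℂ (v k) (v j) = K k j) :
    IsSzegoClass K ↔ ∀ k, innovation v k ≠ 0 := by
  have hpos : (∀ n, 0 < entry (factorArray v) n n) ↔ ∀ k, innovation v k ≠ 0 :=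
    forall_congr' fun k => by
      rw [entry_factorArray_self, Complex.zero_lt_real, norm_pos_iff]
  rw [← hpos]
  constructor
  · rintro ⟨Θ, hΘ, h⟩
    rwa [hΘ.unique (isSpectralFactor_factorArray hK)] at h
  · exact fun h => ⟨_, isSpectralFactor_factorArray hK, h⟩

end Existence

/-! ### Limits of the residuals -/

section Limits

variable {H : Type*} [NormedAddCommGroup H] [InnerProductSpace ℂ H] {v : ℕ → H}

/-- The coefficient of v_k in the backward residual is exactly the inverse of the residual norm, so
rescaling gives the unnormalized residual. -/
lemma residualNorm_smul_backward (hv : LinearIndependent ℂ v) (n k : ℕ) :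
    (residualNorm v n k : ℂ) • backward v n k =
      v k - (windowSpan v k n).starProjection (v k) := by
  have h := isResidual hv n k
  have h0 : (residualNorm v n k : ℂ) ≠ 0 := by exact_mod_cast h.residualNorm_pos.ne'
  have hproj : (windowSpan v k n).starProjection (v k) =
      v k - (residualNorm v n k : ℂ) • backward v n k := by
    refine Submodule.eq_starProjection_of_mem_of_inner_eq_zero ?_ fun w hw => ?_
    · have := Submodule.smul_mem _ (-(residualNorm v n k : ℂ)) h.backward_sub_mem
      rwa [smul_sub, neg_smul, neg_smul, smul_inv_smul₀ h0, sub_neg_eq_add, neg_add_eq_sub] at this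
    · rw [sub_sub_cancel, inner_smul_left,
        inner_eq_zero_symm.1 (inner_eq_zero_of_mem_span h.inner_backward hw), mul_zero]
  rw [hproj, sub_sub_cancel]

/-- The unit vectors f_{n,j} are eventually orthogonal to any finite combination of v_j, v_{j+1}, …;
boundedness extends this to limits of such combinations. -/
lemma tendsto_inner_forward (hv : LinearIndependent ℂ v) {j : ℕ} {x : H}
    (hx : x ∈ tailSpan v j) : Tendsto (fun n => inner ℂ x (forward v n j)) atTop (𝓝 0) := by
  rw [Metric.tendsto_atTop]
  intro ε hε
  rw [← SetLike.mem_coe, Submodule.topologicalClosure_coe, Metric.mem_closure_iff] at hx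
  obtain ⟨y, hy, hxy⟩ := hx ε hε
  obtain ⟨u, hu, rfl⟩ := (Finsupp.mem_span_image_iff_linearCombination ℂ).1 hy
  obtain ⟨N, hN⟩ := u.support.exists_nat_subset_range
  refine ⟨N, fun n hn => ?_⟩
  have hy0 : inner ℂ (Finsupp.linearCombination ℂ v u) (forward v n j) = 0 := by
    refine inner_eq_zero_of_mem_span (isResidual hv n j).inner_forward
      ((Finsupp.mem_span_image_iff_linearCombination ℂ).2 ⟨u, fun i hi => ?_, rfl⟩)
    have h1 := Finset.mem_range.1 (hN hi)
    exact ⟨hu hi, by omega⟩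
  rw [dist_zero_right, ← sub_zero (inner ℂ x _), ← hy0, ← inner_sub_left]
  refine (norm_inner_le_norm _ _).trans_lt ?_
  rwa [(isResidual hv n j).norm_forward, mul_one, ← dist_eq_norm]

lemma prod_Ioc_defect_reflectionFamily (k p : ℕ) :
    ∏ n ∈ Finset.Ioc k (p + k), defect (reflectionFamily v k n) =
      ∏ i ∈ Finset.range p, defect (reflection v i k) := by
  induction p with
  | zero => simp
  | succ p ih =>
    rw [show p + 1 + k = p + k + 1 by omega, Finset.prod_Ioc_succ_top (by omega), ih,
      Finset.prod_range_succ, add_comm p k, reflectionFamily_add]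

variable [CompleteSpace H]

lemma tendsto_residualNorm_smul_backward (hv : LinearIndependent ℂ v) (k : ℕ) :
    Tendsto (fun n => (residualNorm v n k : ℂ) • backward v n k) atTop (𝓝 (innovation v k)) := by
  simp only [residualNorm_smul_backward hv]
  exact tendsto_window_residual v k

lemma tendsto_residualNorm (hv : LinearIndependent ℂ v) (k : ℕ) :
    Tendsto (fun n => residualNorm v n k) atTop (𝓝 ‖innovation v k‖) := by
  refine (tendsto_residualNorm_smul_backward hv k).norm.congr fun n => ?_
  rw [norm_smul, (isResidual hv n k).norm_backward, mul_one, Complex.norm_real,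
    Real.norm_of_nonneg (isResidual hv n k).residualNorm_pos.le]

lemma tendsto_backward (hv : LinearIndependent ℂ v) {k : ℕ} (hk : innovation v k ≠ 0) :
    Tendsto (fun n => backward v n k) atTop (𝓝 (unitInnovation v k)) := by
  have hlim : Tendsto (fun n => (residualNorm v n k : ℂ)⁻¹) atTop
      (𝓝 (‖innovation v k‖⁻¹ : ℂ)) :=
    ((Complex.continuous_ofReal.tendsto _).comp (tendsto_residualNorm hv k)).inv₀
      (by simpa using hk)
  refine (hlim.smul (tendsto_residualNorm_smul_backward hv k)).congr fun n => ?_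
  rw [inv_smul_smul₀]
  exact_mod_cast (isResidual hv n k).residualNorm_pos.ne'

theorem hasPositiveProducts_iff_innovation_ne_zero (hv : LinearIndependent ℂ v)
    {K : Matrix ℕ ℕ ℂ} (hK : ∀ k j, inner ℂ (v k) (v j) = K k j) :
    HasPositiveProducts K (reflectionFamily v) ↔ ∀ k, innovation v k ≠ 0 := by
  refine forall_congr' fun k => ?_
  have hvk : 0 < ‖v k‖ := norm_pos_iff.2 (hv.ne_zero k)
  -- As s_{k,k} = ‖v_k‖², one factor ‖v_k‖ completes the product to the residual norm and the other
  -- stays in front.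
  have hlim : Tendsto (fun m => (K k k).re *
      ∏ n ∈ Finset.Ioc k m, defect (reflectionFamily v k n)) atTop
      (𝓝 (‖v k‖ * ‖innovation v k‖)) := by
    rw [← tendsto_add_atTop_iff_nat k]
    refine ((tendsto_residualNorm hv k).const_mul ‖v k‖).congr fun p => ?_
    have hre : (K k k).re = ‖v k‖ * ‖v k‖ := by
      rw [← hK, ← inner_self_eq_norm_mul_norm (𝕜 := ℂ)]
      rfl
    rw [prod_Ioc_defect_reflectionFamily, residualNorm, hre, mul_assoc]
  constructor
  · rintro ⟨g, hg, hg'⟩ h0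
    have := tendsto_nhds_unique hg' hlim
    rw [h0, norm_zero, mul_zero] at this
    exact hg.ne' this
  · exact fun h => ⟨_, mul_pos hvk (norm_pos_iff.2 h), hlim⟩

variable {K : Matrix ℕ ℕ ℂ}

/-- The entries of Θ Φ_n are ⟨e_i, f_{n,j}⟩ with e_i in the tail from j when i ≥ j, and so tend to
0; the constant factor Θ is then cancelled. -/
theorem convergesTo_arrayPhi (hv : LinearIndependent ℂ v)
    (hK : ∀ k j, inner ℂ (v k) (v j) = K k j) (h : ∀ k, innovation v k ≠ 0) :
    ConvergesTo (arrayPhi K (reflectionFamily v)) 0 := by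
  refine ConvergesTo.of_mul_left (b := fun _ => factorArray v) (B := factorArray v)
    (fun k j => tendsto_const_nhds) (fun k => ?_) fun i j => ?_
  · rw [entry_factorArray_self]
    exact_mod_cast norm_ne_zero_iff.2 (h k)
  rw [mul_zero, entry_zero]
  rcases lt_or_ge i j with hij | hij
  · simp only [entry_of_lt _ hij]
    exact tendsto_const_nhds
  simp only [arrayPhi, entry_mul_mkArray_coeff (entry_factorArray v)
    (fun j => orthPoly K (reflectionFamily v) _ j) hij, (polyVec_polyPair hK _ j).1]
  exact tendsto_inner_forward hv (tailSpan_antitone v hij (unitInnovation_mem_tailSpan v i))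

theorem convergesTo_factorArray_mul_arrayPhiSharp (hv : LinearIndependent ℂ v)
    (hK : ∀ k j, inner ℂ (v k) (v j) = K k j) (h : ∀ k, innovation v k ≠ 0) :
    ConvergesTo (fun n => factorArray v * arrayPhiSharp K (reflectionFamily v) n) 1 := by
  intro i j
  rcases lt_or_ge i j with hij | hij
  · simp only [entry_of_lt _ hij]
    exact tendsto_const_nhds
  simp only [arrayPhiSharp, entry_mul_mkArray_coeff (entry_factorArray v)
    (fun j => orthPolySharp K (reflectionFamily v) _ j) hij, (polyVec_polyPair hK _ j).2]
  have hlim : Tendsto (fun n => inner ℂ (unitInnovation v i) (backward v n j)) atTop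
      (𝓝 (inner ℂ (unitInnovation v i) (unitInnovation v j))) :=
    tendsto_const_nhds.inner (tendsto_backward hv (h j))
  convert hlim using 2
  rw [entry_one]
  split_ifs with hij'
  · rw [hij', inner_self_eq_norm_sq_to_K, norm_unitInnovation (h j)]
    simp
  · rw [inner_unitInnovation_unitInnovation v hij']

/-- Cancels b_n = Θ Φ_n^♯, which tends to 1, in the identity b_n (Φ_n^♯)⁻¹ = Θ; no separate bound on
the inverses is needed. -/
theorem convergesTo_inverse_arrayPhiSharp (hv : LinearIndependent ℂ v)
    (hK : ∀ k j, inner ℂ (v k) (v j) = K k j) (h : ∀ k, innovation v k ≠ 0)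
    (hunit : ∀ n, IsUnit (arrayPhiSharp K (reflectionFamily v) n)) :
    ConvergesTo (fun n => Ring.inverse (arrayPhiSharp K (reflectionFamily v) n))
      (factorArray v) := by
  refine (convergesTo_factorArray_mul_arrayPhiSharp hv hK h).of_mul_left
    (fun k => by simp [entry_one]) fun k j => ?_
  simp only [mul_assoc, Ring.mul_inverse_cancel _ (hunit _), mul_one, one_mul]
  exact tendsto_const_nhds

end Limits

end

end SzegoArrays

theorem theorem3p3 (φ : NCPoly →ₗ[ℂ] ℂ) (hφ : IsStrictlyPositiveFunctional φ) :
    (∃! γ : ℕ → ℕ → ℂ, IsParameterFamily (momentKernel φ) γ) ∧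
    ∀ γ : ℕ → ℕ → ℂ, IsParameterFamily (momentKernel φ) γ →
      (∀ l, IsOrthogonalFamily (shiftKernel (momentKernel φ) l)
        (fun n => orthPoly (momentKernel φ) γ n l)) ∧
      (IsSzegoClass (momentKernel φ) ↔ HasPositiveProducts (momentKernel φ) γ) ∧
      (IsSzegoClass (momentKernel φ) →
        ConvergesTo (arrayPhi (momentKernel φ) γ) 0 ∧
        (∀ n, IsUnit (arrayPhiSharp (momentKernel φ) γ n)) ∧
        (∃! Θ : LowerArray, IsSpectralFactor (momentKernel φ) Θ) ∧
        ∀ Θ : LowerArray, IsSpectralFactor (momentKernel φ) Θ →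
          ConvergesTo (fun n => Ring.inverse (arrayPhiSharp (momentKernel φ) γ n)) Θ) := by
  have hpd := momentKernel_posDef hφ
  obtain ⟨H, _, _, _, v, hK⟩ := exists_gram_eq hpd.posSemidef
  have hv := linearIndependent_of_posDef hpd hK
  have hdiag : ∀ k, 0 < (momentKernel φ k k).re := fun k => by
    have := hpd.2 (x := Finsupp.single k 1) (by simp)
    simpa using (Complex.pos_iff.1 this).1
  have hpar := isParameterFamily_reflectionFamily hv hK
  refine ⟨⟨_, hpar, fun γ hγ => hγ.unique hdiag hpar⟩, fun γ hγ => ?_⟩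
  -- By uniqueness an arbitrary parameter family is the geometric one.
  obtain rfl := hγ.unique hdiag hpar
  refine ⟨isOrthogonalFamily_orthPoly hv hK hdiag, ?_, fun hS => ?_⟩
  · rw [isSzegoClass_iff_innovation_ne_zero hK, hasPositiveProducts_iff_innovation_ne_zero hv hK]
  have hinn := (isSzegoClass_iff_innovation_ne_zero hK).1 hS
  have hfac := isSpectralFactor_factorArray hK
  have hunit := isUnit_arrayPhiSharp hdiag hpar.norm_lt_one
  refine ⟨convergesTo_arrayPhi hv hK hinn, hunit, ⟨_, hfac, fun Θ hΘ => hΘ.unique hfac⟩,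
    fun Θ hΘ => ?_⟩
  rw [hΘ.unique hfac]
  exact convergesTo_inverse_arrayPhiSharp hv hK hinn hunit
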